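/- Let $\mathbb F_q$ be a finite field with $q$ elements, $q$ odd, let $d\ge 2$ and $k\ge 0$ be integers, and for $x\in\mathbb F_q^d$ write $\|x\|=x_1^2+\dots+x_d^2\in\mathbb F_q$. Let $t_1,\dots,t_k\in\mathbb F_q$ be nonzero, put $\vec t=(t_1,\dots,t_k)$, and let $E\subset\mathbb F_q^d$ satisfy $$|E|>\frac{2k}{\ln 2}\,q^{\frac{d+1}{2}}.$$ Define $$C_k(\vec t)=\bigl|\{(x^1,\dots,x^{k+1})\in E^{k+1}:\ \|x^i-x^{i+1}\|=t_i,\ 1\le i\le k\}\bigr|.$$ Then $$C_k(\vec t)=\frac{|E|^{k+1}}{q^k}+\mathcal D_k(\vec t),\qquad |\mathcal D_k(\vec t)|\le\frac{2k}{\ln 2}\,q^{\frac{d+1}{2}}\,\frac{|E|^k}{q^k}.$$ In particular, $C_k(\vec t)>0$. -/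

import Mathlib

/-- The quadratic form `‖x‖ = x₁² + ⋯ + x_d²` on `F^d`; it takes values in `F`. -/
def distForm {F : Type*} [Field F] {d : ℕ} (x : Fin d → F) : F :=
  ∑ j, x j ^ 2

/-- The set of `(k+1)`-tuples `(x⁰, …, xᵏ)` of points of `E` in which the consecutive points
have the prescribed distances: `‖xⁱ - xⁱ⁺¹‖ = tᵢ` for `0 ≤ i < k`. -/
def pathSet {F : Type*} [Field F] {d k : ℕ} (E : Finset (Fin d → F)) (t : Fin k → F) :
    Set (Fin (k + 1) → Fin d → F) :=
  {x | (∀ i, x i ∈ E) ∧ ∀ i : Fin k, distForm (x i.castSucc - x i.succ) = t i}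

/-- The number of such tuples. -/
noncomputable def pathCount {F : Type*} [Field F] {d k : ℕ} (E : Finset (Fin d → F))
    (t : Fin k → F) : ℕ :=
  (pathSet E t).ncard

/-!
Let `A = |E| / q`. The adjacency operator of the graph on `F^d` joining points at distance `t ≠ 0`
is the sum of its main term, the all-ones kernel times `1 / q`, and an error of operator norm at
most `λ = 2 q^{(d+1)/2} / q` (`abs_sum_distForm_le`). Paths in `E` are counted by composing `k` such
operators, compressed to `E`. Replacing each of them by its main term gives `|E| A^k`, and
expanding the product bounds the error by `|E| ((A + λ)^k - A^k)`
(`abs_sum_mul_pathsFrom_sub_le`). Since `k λ / A < log 2` by the hypothesis on `|E|`, convexity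
of `exp` turns this into `|E| A^k · k λ / (A log 2)`, which is the claim.

The operator norm is the largest Fourier coefficient of the sphere. Completing squares expresses these
coefficients as `d`-th powers of a Gauss sum times a Kloosterman sum (`d` even) or a Salié sum
(`d` odd), divided by `q`. Salié sums are evaluated explicitly. For Kloosterman sums `K` one needs
Weil's bound `|K| ≤ 2 √q` (`norm_kloosterman_le`), which is proved from scratch as follows.

* The sum `K_n` over the extension of degree `n` equals `-(αⁿ + βⁿ)`, where `1 + K T + q T²`
  has reciprocal roots `α`, `β`. This comes from the Euler product of the `L`-function
  `∑ w(h) T^{deg h}` over monic polynomials `h`, whose coefficients vanish from degree `3` on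
  (`kloosterman_trace_eq_neg_pow_add_pow`).
* Summing `K_n` over all characters counts the `x` with `Tr (x + a / x) = 0`, hence is controlled
  by the quadratic character of `(z^q - z)² - 4a`. Stepanov's polynomial method
  (`two_mul_card_filter_pow_eq_le`) yields a square root bound for even `n`, with a constant
  independent of `n`.
* Such a bound for the power sums of the numbers `α²`, `β²` belonging to all nontrivial characters
  forces each of them into the disc of radius `q` (`norm_le_of_re_sum_pow_le`).
-/

/-! ### Stepanov's method for the quadratic character of a polynomial -/

open Polynomial in
/-- The Stepanov auxiliary polynomial `∑ (Aⱼ + Dⱼ g) X^{jP}` with `g² ≡ c f (mod X^P)`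
determines its coefficients `Aⱼ`, `Dⱼ`, as long as these have small degree: modulo `X^P` one has
`A₀² = c D₀² f`, which is impossible for squarefree nonconstant `f` unless `A₀ = D₀ = 0`. -/
theorem coeffs_eq_zero_of_sum_eq_zero {K : Type*} [Field K] {f g : K[X]} (hf : Squarefree f)
    {m P : ℕ} (hm : 0 < m) (hdeg : f.natDegree = 2 * m) {c : K} (hc : c ≠ 0)
    (hg : (X : K[X]) ^ P ∣ g ^ 2 - C c * f) {a b : ℕ} (ha : 2 * a < P) (hb : 2 * b + 2 * m < P) :
    ∀ (J : ℕ) (A D : Fin J → K[X]), (∀ j, (A j).natDegree ≤ a) → (∀ j, (D j).natDegree ≤ b) →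
      ∑ j, (A j + D j * g) * (X : K[X]) ^ ((j : ℕ) * P) = 0 → A = 0 ∧ D = 0 := by
  intro J
  induction J with
  | zero => intro A D _ _ _; exact ⟨Subsingleton.elim _ _, Subsingleton.elim _ _⟩
  | succ J ih =>
    intro A D hA hD hsum
    rw [Fin.sum_univ_succ] at hsum
    have hshift : ∑ j : Fin J, (A j.succ + D j.succ * g) * (X : K[X]) ^ ((j.succ : ℕ) * P)
        = X ^ P * ∑ j : Fin J, (A j.succ + D j.succ * g) * (X : K[X]) ^ ((j : ℕ) * P) := by
      rw [Finset.mul_sum]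
      refine Finset.sum_congr rfl fun j _ => ?_
      rw [Fin.val_succ, add_one_mul (j : ℕ) P, pow_add]; ring
    rw [hshift] at hsum
    simp only [Fin.val_zero, zero_mul, pow_zero, mul_one] at hsum
    have h1 : (X : K[X]) ^ P ∣ A 0 + D 0 * g :=
      (dvd_add_left (dvd_mul_right _ _)).1 (hsum ▸ dvd_zero _)
    have h2 : (X : K[X]) ^ P ∣ A 0 ^ 2 - C c * f * D 0 ^ 2 := by
      have := (h1.mul_right (A 0 - D 0 * g)).add (hg.mul_left (D 0 ^ 2))
      convert this using 1; ring
    have hlt : (A 0 ^ 2 - C c * f * D 0 ^ 2).natDegree < P := by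
      refine lt_of_le_of_lt (natDegree_sub_le _ _) (max_lt ?_ ?_)
      · have := natDegree_pow_le (p := A 0) (n := 2); have := hA 0; omega
      · have h3 := natDegree_pow_le (p := D 0) (n := 2)
        have h4 := natDegree_mul_le (p := C c * f) (q := D 0 ^ 2)
        have h5 := natDegree_C_mul_le c f
        have := hD 0; omega
    have h3 : A 0 ^ 2 = C c * f * D 0 ^ 2 := by
      by_contra hne
      have := natDegree_le_of_dvd h2 (sub_ne_zero.2 hne)
      rw [natDegree_X_pow] at this; omega
    have hD0 : D 0 = 0 := by
      by_contra hD0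
      obtain ⟨B, hB⟩ : D 0 ∣ A 0 := (IsIntegrallyClosed.pow_dvd_pow_iff two_ne_zero).1 (h3 ▸ dvd_mul_left _ _)
      have h4 : B * B = C c * f := by
        apply mul_right_cancel₀ (pow_ne_zero 2 hD0)
        rw [← h3, hB]; ring
      have hu : IsUnit B := by
        apply hf B
        rw [h4]
        exact ⟨C c⁻¹, by rw [mul_right_comm, ← C_mul, mul_inv_cancel₀ hc, C_1, one_mul]⟩
      have h5 := natDegree_eq_zero_of_isUnit (hu.mul hu)
      rw [h4, natDegree_C_mul hc] at h5
      omega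
    have hA0 : A 0 = 0 := by
      rw [hD0] at h3; simpa using h3
    rw [hA0, hD0, zero_mul, zero_add, zero_add] at hsum
    have hsum' := (mul_eq_zero.1 hsum).resolve_left (pow_ne_zero _ X_ne_zero)
    obtain ⟨h6, h7⟩ := ih (fun j => A j.succ) (fun j => D j.succ) (fun j => hA _) (fun j => hD _)
      hsum'
    constructor
    · funext j; refine Fin.cases hA0 (fun i => congrFun h6 i) j
    · funext j; refine Fin.cases hD0 (fun i => congrFun h7 i) j

open Polynomial in
theorem finrank_degreeLT {K : Type*} [Field K] (n : ℕ) : Module.finrank K (degreeLT K n) = n := by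
  rw [(degreeLTEquiv K n).finrank_eq, Module.finrank_fin_fun]

open Polynomial in
theorem mem_degreeLT_of_natDegree_lt {K : Type*} [Field K] {n : ℕ} {f : K[X]}
    (h : f.natDegree < n) : f ∈ degreeLT K n :=
  mem_degreeLT.2 (degree_le_natDegree.trans_lt (by exact_mod_cast h))

open Polynomial in
theorem natDegree_le_of_mem_degreeLT {K : Type*} [Field K] {n : ℕ} {f : K[X]}
    (h : f ∈ degreeLT K (n + 1)) : f.natDegree ≤ n := by
  rw [degreeLT_succ_eq_degreeLE, mem_degreeLE] at h
  exact natDegree_le_iff_degree_le.2 h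

open Polynomial in
/-- **Stepanov's bound.** Over a field with `P²` elements, `P = 2h + 1`, a squarefree polynomial `f`
of degree `2m` takes values with a prescribed quadratic character at no more than
`P²/2 + O(mP)` points; here `2h² + 2h = (P² - 1) / 2`, so the power defining the set is the
quadratic character of `f(x)`. The auxiliary polynomial `G = ∑ (Aⱼ + Dⱼ f^{h+1}) X^{jP}` vanishes at
all those points because there `G^P` agrees with a polynomial that is identically zero by the
choice of the `Aⱼ`, `Dⱼ`. -/
theorem two_mul_card_filter_pow_eq_le {K : Type*} [Field K] [Fintype K] [DecidableEq K]
    {p e h : ℕ} [ExpChar K p] (hP : p ^ e = 2 * h + 1) (hcard : Fintype.card K = (2 * h + 1) ^ 2)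
    {f : K[X]} (hf : Squarefree f) {m : ℕ} (hm : 0 < m) (hmh : m ≤ h)
    (hdeg : f.natDegree = 2 * m) (hf0 : f.eval 0 ≠ 0) (ε : K) :
    2 * (Finset.univ.filter fun x : K => f.eval x ^ (2 * h ^ 2 + 2 * h) = ε).card
      ≤ (2 * h + 1) ^ 2 + 4 * m * (2 * h + 1) := by
  set P := 2 * h + 1 with hPdef
  have hPpos : 0 < P := by omega
  let φ : K ≃+* K := iterateFrobeniusEquiv K p e
  have hφ : ∀ x, φ x = x ^ P := fun x => by
    simp only [φ, iterateFrobeniusEquiv_apply, iterateFrobenius_def, hP]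
  have hhm : h + 1 - m = h - m + 1 := by omega
  -- a value of `J` for which the unknowns below outnumber the linear conditions
  set J := h + m + 1 with hJ
  -- the conditions on the coefficients, in terms of their images under Frobenius
  let Λ : (Fin J → degreeLT K (h + 1)) × (Fin J → degreeLT K (h + 1 - m)) →ₗ[K]
      degreeLT K (h * P + m + J) :=
    LinearMap.codRestrict _
      (LinearMap.coprod
        (∑ j : Fin J, (LinearMap.mulRight K ((X : K[X]) ^ (j : ℕ))) ∘ₗ
          (expand K P).toLinearMap ∘ₗ (Submodule.subtype _) ∘ₗ LinearMap.proj j)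
        (∑ j : Fin J, (LinearMap.mulRight K (C ε * f ^ (h + 1) * (X : K[X]) ^ (j : ℕ))) ∘ₗ
          (expand K P).toLinearMap ∘ₗ (Submodule.subtype _) ∘ₗ LinearMap.proj j))
      (by
        rintro ⟨A, D⟩
        simp only [LinearMap.coprod_apply, LinearMap.sum_apply, LinearMap.comp_apply,
          LinearMap.proj_apply, Submodule.subtype_apply, AlgHom.toLinearMap_apply,
          LinearMap.mulRight_apply]
        refine Submodule.add_mem _ (Submodule.sum_mem _ fun j _ => ?_)
          (Submodule.sum_mem _ fun j _ => ?_) <;> apply mem_degreeLT_of_natDegree_lt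
        · have h1 : ((A j : K[X])).natDegree ≤ h := natDegree_le_of_mem_degreeLT (A j).2
          have h2 := natDegree_mul_le (p := expand K P (A j : K[X])) (q := X ^ (j : ℕ))
          rw [natDegree_expand, natDegree_X_pow] at h2
          have := Nat.mul_le_mul_right P h1
          omega
        · have h1 : ((D j : K[X])).natDegree ≤ h - m :=
            natDegree_le_of_mem_degreeLT (by rw [← hhm]; exact (D j).2)
          have h2 := natDegree_mul_le (p := expand K P (D j : K[X]))
            (q := C ε * f ^ (h + 1) * X ^ (j : ℕ))
          have h3 := natDegree_mul_le (p := C ε * f ^ (h + 1)) (q := X ^ (j : ℕ))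
          have h4 := natDegree_C_mul_le ε (f ^ (h + 1))
          have h5 := natDegree_pow_le (p := f) (n := h + 1)
          rw [natDegree_expand] at h2
          rw [natDegree_X_pow] at h3
          have h6 := Nat.mul_le_mul_right P h1
          have h7 : (h - m) * P + (h + 1) * (2 * m) = h * P + m := by
            obtain ⟨k, rfl⟩ := Nat.exists_eq_add_of_le hmh
            rw [hPdef, Nat.add_sub_cancel_left]; ring
          rw [hdeg] at h5
          omega)
  obtain ⟨⟨A, D⟩, hAD, hne⟩ : ∃ v ∈ LinearMap.ker Λ, v ≠ 0 := by
    refine (Submodule.ne_bot_iff _).1 (LinearMap.ker_ne_bot_of_finrank_lt ?_)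
    rw [finrank_degreeLT, Module.finrank_prod, Module.finrank_pi_fintype,
      Module.finrank_pi_fintype]
    simp only [finrank_degreeLT, Finset.sum_const, Finset.card_univ, Fintype.card_fin,
      smul_eq_mul]
    obtain ⟨k, rfl⟩ := Nat.exists_eq_add_of_le hmh
    rw [hJ, hPdef, add_assoc m k 1, Nat.add_sub_cancel_left]
    nlinarith
  have hker := congrArg Subtype.val (LinearMap.mem_ker.1 hAD)
  simp only [Λ, LinearMap.codRestrict_apply, LinearMap.coprod_apply, LinearMap.sum_apply,
    LinearMap.comp_apply, LinearMap.proj_apply, Submodule.subtype_apply,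
    AlgHom.toLinearMap_apply, LinearMap.mulRight_apply, Submodule.coe_zero] at hker
  let A' : Fin J → K[X] := fun j => (A j : K[X]).map (φ.symm : K →+* K)
  let D' : Fin J → K[X] := fun j => (D j : K[X]).map (φ.symm : K →+* K)
  have hA' : ∀ j, (A' j).natDegree ≤ h := fun j =>
    natDegree_map_le.trans (natDegree_le_of_mem_degreeLT (A j).2)
  have hD' : ∀ j, (D' j).natDegree ≤ h - m := fun j =>
    natDegree_map_le.trans (natDegree_le_of_mem_degreeLT (by rw [← hhm]; exact (D j).2))
  have hev : ∀ (B : K[X]) (x : K), (B.map (φ.symm : K →+* K)).eval x ^ P = B.eval (x ^ P) := by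
    intro B x
    rw [← hφ, ← hφ]
    have := eval_map_apply (f := (φ.symm : K →+* K)) (p := B) (φ x)
    simp only [RingHom.coe_coe, RingEquiv.symm_apply_apply] at this
    rw [this, RingEquiv.apply_symm_apply]
  set G : K[X] := ∑ j, (A' j + D' j * f ^ (h + 1)) * X ^ ((j : ℕ) * P) with hG
  have hG0 : G ≠ 0 := by
    intro hG0
    obtain ⟨hA0, hD0⟩ := coeffs_eq_zero_of_sum_eq_zero hf hm hdeg (pow_ne_zero P hf0)
      (g := f ^ (h + 1)) (P := P) (a := h) (b := h - m) (by
        have h1 : (X : K[X]) ^ P ∣ f ^ P - C (f.eval 0 ^ P) := by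
          obtain ⟨k, hk⟩ : X ∣ f - C (f.eval 0) := by
            rw [X_dvd_iff, coeff_sub, coeff_C_zero, coeff_zero_eq_eval_zero, sub_self]
          refine ⟨k ^ P, ?_⟩
          rw [← mul_pow, ← hk, ← hP, sub_pow_expChar_pow, C_pow]
        convert h1.mul_left f using 1
        rw [hPdef]; ring) (by omega) (by omega) J A' D' hA' hD' hG0
    apply hne
    have hinj : Function.Injective (Polynomial.map (φ.symm : K →+* K)) :=
      map_injective _ φ.symm.injective
    ext1
    · funext j
      apply Subtype.ext
      apply hinj
      have := congrFun hA0 j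
      simpa [A'] using this
    · funext j
      apply Subtype.ext
      apply hinj
      have := congrFun hD0 j
      simpa [D'] using this
  have hGdeg : G.natDegree ≤ h + (h + 2 * m) * P := by
    refine natDegree_sum_le_of_forall_le _ _ fun j _ => ?_
    have h1 := natDegree_mul_le (p := A' j + D' j * f ^ (h + 1)) (q := X ^ ((j : ℕ) * P))
    rw [natDegree_X_pow] at h1
    have h2 := natDegree_add_le (A' j) (D' j * f ^ (h + 1))
    have h3 := natDegree_mul_le (p := D' j) (q := f ^ (h + 1))
    have h5 := natDegree_pow_le (p := f) (n := h + 1)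
    rw [hdeg] at h5
    have h6 := hA' j
    have h7 := hD' j
    have h8 : h - m + (h + 1) * (2 * m) = h + m * P := by
      obtain ⟨k, rfl⟩ := Nat.exists_eq_add_of_le hmh
      rw [hPdef, Nat.add_sub_cancel_left]; ring
    have h9 : (j : ℕ) * P ≤ (h + m) * P := Nat.mul_le_mul_right P (by have := j.2; omega)
    have h10 : (h + 2 * m) * P = (h + m) * P + m * P := by ring
    have h11 : max (A' j).natDegree (D' j * f ^ (h + 1)).natDegree ≤ h + m * P :=
      max_le (by omega) (by omega)
    omega
  have hsub : (Finset.univ.filter fun x : K => f.eval x ^ (2 * h ^ 2 + 2 * h) = ε)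
      ⊆ G.roots.toFinset := by
    intro x hx
    rw [Finset.mem_filter] at hx
    rw [Multiset.mem_toFinset, mem_roots hG0, IsRoot.def]
    refine pow_eq_zero_iff hPpos.ne' |>.1 ?_
    have hxq : (x ^ P) ^ P = x := by
      rw [← pow_mul, ← sq, hPdef, ← hcard, FiniteField.pow_card]
    have hfP : (f.eval x ^ (h + 1)) ^ P = ε * f.eval x ^ (h + 1) := by
      rw [← hx.2, ← pow_mul, ← pow_add]; congr 1; rw [hPdef]; ring
    have := congrArg (eval x) hker
    rw [← hφ, hG, eval_finsetSum, map_sum]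
    rw [eval_add, eval_finsetSum, eval_finsetSum, ← Finset.sum_add_distrib, eval_zero] at this
    rw [← this]
    refine Finset.sum_congr rfl fun j _ => ?_
    rw [eval_mul, eval_add, eval_mul, map_mul, map_add, map_mul]
    simp only [hφ, eval_pow, eval_X, eval_mul, eval_C, expand_eval]
    rw [hfP, hev, hev, mul_comm (j : ℕ) P, pow_mul, ← pow_mul, mul_comm (j : ℕ) P, pow_mul, hxq]
    ring
  have h1 := (Finset.card_le_card hsub).trans ((Multiset.toFinset_card_le _).trans
    ((card_roots' G).trans hGdeg))
  rw [hPdef] at h1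
  rw [hPdef]
  nlinarith

/-! ### Monic polynomials over a finite field and the weight of Kloosterman sums -/

open Polynomial in
/-- The monic polynomial of degree `n` with the given lower coefficients. -/
noncomputable def monicPoly {F : Type*} [Field F] {n : ℕ} (c : Fin n → F) : F[X] :=
  X ^ n + ∑ i : Fin n, monomial (i : ℕ) (c i)

open Polynomial in
theorem coeff_monicPoly {F : Type*} [Field F] {n : ℕ} (c : Fin n → F) (i : Fin n) :
    (monicPoly c).coeff i = c i := by
  rw [monicPoly, coeff_add, coeff_X_pow, if_neg i.2.ne, zero_add, finsetSum_coeff]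
  simp only [coeff_monomial, Fin.val_inj]
  simp

open Polynomial in
theorem monic_monicPoly {F : Type*} [Field F] {n : ℕ} (c : Fin n → F) : (monicPoly c).Monic := by
  refine monic_X_pow_add ((degree_sum_le _ _).trans_lt ((Finset.sup_lt_iff (by simp)).2 ?_))
  exact fun i _ => (degree_monomial_le _ _).trans_lt (by exact_mod_cast i.2)

open Polynomial in
theorem natDegree_monicPoly {F : Type*} [Field F] {n : ℕ} (c : Fin n → F) :
    (monicPoly c).natDegree = n := by
  refine natDegree_eq_of_degree_eq_some ?_
  have h : (∑ i : Fin n, monomial (i : ℕ) (c i)).degree < (X ^ n : F[X]).degree := by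
    rw [degree_X_pow]
    refine (degree_sum_le _ _).trans_lt ((Finset.sup_lt_iff (by simp)).2 ?_)
    exact fun i _ => (degree_monomial_le _ _).trans_lt (by exact_mod_cast i.2)
  rw [monicPoly, degree_add_eq_left_of_degree_lt h, degree_X_pow]

open Polynomial in
theorem nextCoeff_monicPoly {F : Type*} [Field F] {n : ℕ} (c : Fin (n + 1) → F) :
    (monicPoly c).nextCoeff = c (Fin.last n) := by
  rw [nextCoeff_of_natDegree_pos (by rw [natDegree_monicPoly]; omega), natDegree_monicPoly]
  exact coeff_monicPoly c (Fin.last n)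

theorem monicPoly_injective {F : Type*} [Field F] {n : ℕ} :
    Function.Injective (monicPoly : (Fin n → F) → Polynomial F) := fun c c' h => by
  funext i
  rw [← coeff_monicPoly c, h, coeff_monicPoly]

/-- The monic polynomials of degree `n` over a finite field. -/
noncomputable def monicPolys (F : Type*) [Field F] [Fintype F] (n : ℕ) :
    Finset (Polynomial F) :=
  Finset.univ.map ⟨(monicPoly : (Fin n → F) → Polynomial F), monicPoly_injective⟩

open Polynomial in
theorem mem_monicPolys {F : Type*} [Field F] [Fintype F] {n : ℕ} {h : F[X]} :
    h ∈ monicPolys F n ↔ h.Monic ∧ h.natDegree = n := by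
  simp only [monicPolys, Finset.mem_map, Finset.mem_univ, true_and, Function.Embedding.coeFn_mk]
  constructor
  · rintro ⟨c, rfl⟩; exact ⟨monic_monicPoly c, natDegree_monicPoly c⟩
  · rintro ⟨hh, rfl⟩
    refine ⟨fun i => h.coeff i, ?_⟩
    ext i
    rcases lt_trichotomy i h.natDegree with hi | rfl | hi
    · exact coeff_monicPoly _ ⟨i, hi⟩
    · rw [hh.coeff_natDegree]
      have := (monic_monicPoly fun i : Fin h.natDegree => h.coeff i).coeff_natDegree
      rwa [natDegree_monicPoly] at this
    · rw [coeff_eq_zero_of_natDegree_lt hi, coeff_eq_zero_of_natDegree_lt]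
      rwa [natDegree_monicPoly]

theorem sum_monicPolys {F : Type*} [Field F] [Fintype F] (n : ℕ) (f : Polynomial F → ℂ) :
    ∑ h ∈ monicPolys F n, f h = ∑ c : Fin n → F, f (monicPoly c) := by
  rw [monicPolys, Finset.sum_map]
  rfl

open Polynomial in
/-- The completely multiplicative weight on monic polynomials `h` whose Dirichlet series is the
`L`-function of the Kloosterman sums: if `h` has roots `ρ`, then its value is
`ψ (∑ ρ + a ∑ ρ⁻¹)`, and `0` if `0` is a root. -/
noncomputable def kloostermanWeight {F : Type*} [Field F] (ψ : AddChar F ℂ) (a : F) (h : F[X]) :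
    ℂ :=
  open Classical in
  if h.coeff 0 = 0 then 0 else ψ (-h.nextCoeff - a * (h.coeff 1 / h.coeff 0))

open Polynomial in
theorem kloostermanWeight_mul {F : Type*} [Field F] (ψ : AddChar F ℂ) (a : F) {g h : F[X]}
    (hg : g.Monic) (hh : h.Monic) :
    kloostermanWeight ψ a (g * h) = kloostermanWeight ψ a g * kloostermanWeight ψ a h := by
  unfold kloostermanWeight
  rw [mul_coeff_zero, mul_coeff_one, hg.nextCoeff_mul hh]
  by_cases h1 : g.coeff 0 = 0
  · simp [h1]
  by_cases h2 : h.coeff 0 = 0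
  · simp [h2]
  rw [if_neg (mul_ne_zero h1 h2), if_neg h1, if_neg h2, ← AddChar.map_add_eq_mul]
  congr 1
  field_simp
  ring

open Polynomial in
theorem kloostermanWeight_one {F : Type*} [Field F] (ψ : AddChar F ℂ) (a : F) :
    kloostermanWeight ψ a 1 = 1 := by
  have h : nextCoeff (1 : F[X]) = 0 := nextCoeff_C_eq_zero 1
  simp [kloostermanWeight, coeff_one, h]

open Polynomial in
theorem kloostermanWeight_pow {F : Type*} [Field F] (ψ : AddChar F ℂ) (a : F) {g : F[X]}
    (hg : g.Monic) (n : ℕ) :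
    kloostermanWeight ψ a (g ^ n) = kloostermanWeight ψ a g ^ n := by
  induction n with
  | zero => simp [kloostermanWeight_one]
  | succ n ih => rw [pow_succ, kloostermanWeight_mul ψ a (hg.pow n) hg, ih, pow_succ]

/-- The Kloosterman sum `∑_{x ≠ 0} ψ (x + a / x)`. -/
noncomputable def kloosterman {F : Type*} [Field F] [Fintype F] (ψ : AddChar F ℂ) (a : F) : ℂ :=
  open Classical in
  ∑ x : F, if x = 0 then 0 else ψ (x + a * x⁻¹)

theorem sum_kloostermanWeight_zero {F : Type*} [Field F] [Fintype F] (ψ : AddChar F ℂ) (a : F) :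
    ∑ h ∈ monicPolys F 0, kloostermanWeight ψ a h = 1 := by
  rw [sum_monicPolys]
  simp [monicPoly, kloostermanWeight_one]

theorem sum_kloostermanWeight_one {F : Type*} [Field F] [Fintype F] (ψ : AddChar F ℂ) (a : F) :
    ∑ h ∈ monicPolys F 1, kloostermanWeight ψ a h = kloosterman ψ a := by
  classical
  rw [sum_monicPolys, kloosterman]
  refine Fintype.sum_equiv ((Equiv.funUnique (Fin 1) F).trans (Equiv.neg F)) _ _ fun c => ?_
  have h0 := coeff_monicPoly c 0
  have h1 := nextCoeff_monicPoly (n := 0) c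
  rw [Fin.val_zero] at h0
  have h2 : Fin.last 0 = 0 := rfl
  have h3 : (Equiv.funUnique (Fin 1) F).trans (Equiv.neg F) c = - c 0 := rfl
  unfold kloostermanWeight
  rw [h0, h1, h2, h3]
  simp only [neg_eq_zero]
  split_ifs with h
  · rfl
  · congr 1
    have h4 : (monicPoly c).coeff 1 = 1 := by
      simp [monicPoly]
    rw [h4]
    field_simp
    ring

theorem sum_kloostermanWeight_two {F : Type*} [Field F] [Fintype F] {ψ : AddChar F ℂ}
    (hψ : ψ.IsPrimitive) {a : F} (ha : a ≠ 0) :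
    ∑ h ∈ monicPolys F 2, kloostermanWeight ψ a h = Fintype.card F := by
  classical
  rw [sum_monicPolys]
  rw [Fintype.sum_equiv (finTwoArrowEquiv F) _
    (fun c : F × F => if c.1 = 0 then 0 else ψ (c.2 * (-1 - a / c.1))) (fun c => ?_)]
  · rw [Fintype.sum_prod_type]
    rw [Finset.sum_eq_single (-a)]
    · simp [ha]
    · intro x _ hx
      dsimp only
      split_ifs with h0
      · simp
      · have := AddChar.sum_mulShift (-1 - a / x) hψ
        rw [if_neg] at this
        · simpa using this
        · intro h; apply hx; field_simp at h; linear_combination -h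
    · simp
  · have h0 := coeff_monicPoly c 0
    have h1 := coeff_monicPoly c 1
    have h2 := nextCoeff_monicPoly (n := 1) c
    have h3 : Fin.last 1 = 1 := rfl
    rw [Fin.val_zero] at h0
    rw [Fin.val_one] at h1
    unfold kloostermanWeight
    rw [h0, h1, h2, h3]
    have h4 : finTwoArrowEquiv F c = (c 0, c 1) := rfl
    rw [h4]
    dsimp only
    split_ifs with h
    · rfl
    · congr 1
      field_simp

theorem sum_kloostermanWeight_add_three {F : Type*} [Field F] [Fintype F] {ψ : AddChar F ℂ}
    (hψ : ψ ≠ 1) (a : F) (n : ℕ) :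
    ∑ h ∈ monicPolys F (n + 3), kloostermanWeight ψ a h = 0 := by
  classical
  obtain ⟨u, hu⟩ := AddChar.ne_one_iff.1 hψ
  rw [sum_monicPolys]
  set g : (Fin (n + 3) → F) → ℂ := fun c =>
    kloostermanWeight ψ a (monicPoly c) with hg
  -- the weight depends on the second highest coefficient only through `nextCoeff`, as the degree
  -- is at least three, so translating that coefficient multiplies the sum by `ψ u ≠ 1`
  have hshift : ∀ c, g (c + Pi.single (Fin.last (n + 2)) (-u)) = ψ u * g c := by
    intro c
    have h0 := fun c : Fin (n + 3) → F => coeff_monicPoly c 0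
    have h1 := fun c : Fin (n + 3) → F => coeff_monicPoly c 1
    have h2 := fun c : Fin (n + 3) → F => nextCoeff_monicPoly (n := n + 2) c
    rw [Fin.val_zero] at h0
    rw [Fin.val_one] at h1
    simp only [hg, kloostermanWeight, h0, h1, h2]
    have e0 : (0 : Fin (n + 3)) ≠ Fin.last (n + 2) := by simp [Fin.ext_iff]
    have e1 : (1 : Fin (n + 3)) ≠ Fin.last (n + 2) := by simp [Fin.ext_iff]
    simp only [Pi.add_apply, Pi.single_eq_of_ne e0, Pi.single_eq_of_ne e1, Pi.single_eq_same,
      add_zero]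
    split_ifs
    · simp
    · rw [← AddChar.map_add_eq_mul]; congr 1; ring
  have hsum : ∑ c, g c = ψ u * ∑ c, g c := by
    rw [Finset.mul_sum, ← Equiv.sum_comp (Equiv.addRight (Pi.single (Fin.last (n + 2)) (-u))) g]
    exact Finset.sum_congr rfl fun c _ => hshift c
  have : (ψ u - 1) * ∑ c, g c = 0 := by linear_combination -hsum
  exact (mul_eq_zero.1 this).resolve_left (sub_ne_zero.2 hu)

/-! ### The Euler product -/

open Classical in
/-- The monic irreducible polynomials of degree `n` over a finite field. -/
noncomputable def irredPolys (F : Type*) [Field F] [Fintype F] (n : ℕ) :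
    Finset (Polynomial F) :=
  (monicPolys F n).filter Irreducible

theorem mem_irredPolys {F : Type*} [Field F] [Fintype F] {n : ℕ} {h : Polynomial F} :
    h ∈ irredPolys F n ↔ h.Monic ∧ h.natDegree = n ∧ Irreducible h := by
  classical
  rw [irredPolys, Finset.mem_filter, mem_monicPolys, and_assoc]

open Polynomial UniqueFactorizationMonoid in
open Classical in
/-- The degree of a monic polynomial is the sum of the degrees of the irreducible polynomials
`P`, over all prime powers `P ^ j` dividing it. -/
theorem sum_natDegree_prime_pow_dvd {F : Type*} [Field F] [Fintype F] {n : ℕ} {h : F[X]}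
    (hh : h ∈ monicPolys F n) :
    ∑ e ∈ Finset.Icc 1 n, ∑ P ∈ irredPolys F e, ∑ j ∈ Finset.Icc 1 n,
      (if P ^ j ∣ h then e else 0) = n := by
  obtain ⟨hm, hn⟩ := mem_monicPolys.1 hh
  have h0 := hm.ne_zero
  have hcount : ∀ P : F[X], P.Monic → Irreducible P →
      ∑ j ∈ Finset.Icc 1 n, (if P ^ j ∣ h then P.natDegree else 0)
        = (normalizedFactors h).count P * P.natDegree := by
    intro P hP hPi
    have key : ∀ j, P ^ j ∣ h ↔ j ≤ (normalizedFactors h).count P := by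
      intro j
      rw [pow_dvd_iff_le_emultiplicity, emultiplicity_eq_count_normalizedFactors hPi h0,
        hP.normalize_eq_self]
      exact Nat.cast_le
    have hle : (normalizedFactors h).count P ≤ n := by
      have h1 := natDegree_le_of_dvd ((key _).2 le_rfl) h0
      rw [natDegree_pow, hn] at h1
      exact (Nat.le_mul_of_pos_right _ hPi.natDegree_pos).trans h1
    rw [← Finset.sum_filter, Finset.sum_const, smul_eq_mul]
    congr 1
    have : (Finset.Icc 1 n).filter (fun j => P ^ j ∣ h)
        = Finset.Icc 1 ((normalizedFactors h).count P) := by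
      ext j
      simp only [Finset.mem_filter, Finset.mem_Icc, key]
      omega
    rw [this, Nat.card_Icc, Nat.add_sub_cancel]
  have hmem : ∀ P, P ∈ normalizedFactors h ↔ Irreducible P ∧ P.Monic ∧ P ∣ h := fun P =>
    Polynomial.mem_normalizedFactors_iff h0
  have hdisj : Set.PairwiseDisjoint (↑(Finset.Icc 1 n)) (irredPolys F) := by
    intro e _ e' _ hne
    refine Finset.disjoint_left.2 fun P hP hP' => hne ?_
    rw [← (mem_irredPolys.1 hP).2.1, (mem_irredPolys.1 hP').2.1]
  have hsub : (normalizedFactors h).toFinset ⊆ (Finset.Icc 1 n).biUnion (irredPolys F) := by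
    intro P hP
    obtain ⟨h1, h2, h3⟩ := (hmem P).1 (Multiset.mem_toFinset.1 hP)
    refine Finset.mem_biUnion.2 ⟨P.natDegree, Finset.mem_Icc.2 ⟨h1.natDegree_pos, ?_⟩,
      mem_irredPolys.2 ⟨h2, rfl, h1⟩⟩
    rw [← hn]; exact natDegree_le_of_dvd h3 h0
  calc _ = ∑ e ∈ Finset.Icc 1 n, ∑ P ∈ irredPolys F e,
        (normalizedFactors h).count P * P.natDegree := by
        refine Finset.sum_congr rfl fun e _ => Finset.sum_congr rfl fun P hP => ?_
        obtain ⟨h1, rfl, h3⟩ := mem_irredPolys.1 hP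
        exact hcount P h1 h3
    _ = ∑ P ∈ (Finset.Icc 1 n).biUnion (irredPolys F),
        (normalizedFactors h).count P * P.natDegree := (Finset.sum_biUnion hdisj).symm
    _ = ((normalizedFactors h).map natDegree).sum := by
        rw [Finset.sum_multiset_map_count]
        symm
        refine Finset.sum_subset hsub fun P _ hP => ?_
        rw [Multiset.mem_toFinset] at hP
        rw [Multiset.count_eq_zero_of_notMem hP, zero_smul]
    _ = n := by
        rw [← natDegree_multiset_prod_of_monic _ fun P hP => ((hmem P).1 hP).2.1,
          prod_normalizedFactors_eq h0, hm.normalize_eq_self, hn]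

open Polynomial in
theorem sum_kloostermanWeight_pow_dvd {F : Type*} [Field F] [Fintype F] (ψ : AddChar F ℂ) (a : F)
    {n e j : ℕ} {P : F[X]} (hP : P.Monic) (he : P.natDegree = e) :
    open Classical in
    ∑ h ∈ monicPolys F n, (if P ^ j ∣ h then kloostermanWeight ψ a h else 0)
      = if e * j ≤ n then kloostermanWeight ψ a P ^ j *
          ∑ h ∈ monicPolys F (n - e * j), kloostermanWeight ψ a h else 0 := by
  classical
  have hPj := hP.pow j
  have hdeg : (P ^ j).natDegree = e * j := by rw [natDegree_pow, he, mul_comm]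
  split_ifs with hle
  · rw [← Finset.sum_filter, Finset.mul_sum]
    symm
    refine Finset.sum_bij (fun g _ => P ^ j * g) ?_ ?_ ?_ ?_
    · intro g hg
      obtain ⟨h1, h2⟩ := mem_monicPolys.1 hg
      refine Finset.mem_filter.2 ⟨mem_monicPolys.2 ⟨hPj.mul h1, ?_⟩, dvd_mul_right _ _⟩
      rw [hPj.natDegree_mul h1, hdeg, h2]; omega
    · intro g _ g' _ h
      exact mul_left_cancel₀ hPj.ne_zero h
    · intro h hh
      obtain ⟨hh, g, rfl⟩ := Finset.mem_filter.1 hh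
      obtain ⟨h1, h2⟩ := mem_monicPolys.1 hh
      have h3 := hPj.of_mul_monic_left h1
      refine ⟨g, mem_monicPolys.2 ⟨h3, ?_⟩, rfl⟩
      rw [hPj.natDegree_mul h3, hdeg] at h2; omega
    · intro g hg
      rw [kloostermanWeight_mul ψ a hPj (mem_monicPolys.1 hg).1, kloostermanWeight_pow ψ a hP]
  · refine Finset.sum_eq_zero fun h hh => if_neg fun hd => hle ?_
    obtain ⟨h1, h2⟩ := mem_monicPolys.1 hh
    have := natDegree_le_of_dvd hd h1.ne_zero
    omega

/-- The logarithmic derivative of the Euler product of `kloostermanWeight`, in terms of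
coefficients: the `n`-th coefficient of `L'` is the convolution of the coefficients of `L` with
the sums of the weight over prime powers. -/
theorem mul_sum_kloostermanWeight {F : Type*} [Field F] [Fintype F] (ψ : AddChar F ℂ) (a : F)
    (n : ℕ) :
    (n : ℂ) * ∑ h ∈ monicPolys F n, kloostermanWeight ψ a h
      = ∑ k ∈ Finset.Icc 1 n, (∑ e ∈ Finset.Icc 1 n, ∑ j ∈ Finset.Icc 1 n,
          if e * j = k then ∑ P ∈ irredPolys F e, (e : ℂ) * kloostermanWeight ψ a P ^ j else 0)
          * ∑ h ∈ monicPolys F (n - k), kloostermanWeight ψ a h := by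
  classical
  calc _ = ∑ h ∈ monicPolys F n, ∑ e ∈ Finset.Icc 1 n, ∑ P ∈ irredPolys F e,
        ∑ j ∈ Finset.Icc 1 n, (e : ℂ) * (if P ^ j ∣ h then kloostermanWeight ψ a h else 0) := by
        rw [Finset.mul_sum]
        refine Finset.sum_congr rfl fun h hh => ?_
        have := congrArg (Nat.cast : ℕ → ℂ) (sum_natDegree_prime_pow_dvd hh)
        push_cast at this
        rw [← this]
        simp only [Finset.sum_mul]
        refine Finset.sum_congr rfl fun e _ => Finset.sum_congr rfl fun P _ =>
          Finset.sum_congr rfl fun j _ => ?_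
        split_ifs <;> simp
    _ = ∑ e ∈ Finset.Icc 1 n, ∑ P ∈ irredPolys F e, ∑ j ∈ Finset.Icc 1 n,
        (e : ℂ) * (if e * j ≤ n then kloostermanWeight ψ a P ^ j *
          ∑ h ∈ monicPolys F (n - e * j), kloostermanWeight ψ a h else 0) := by
        rw [Finset.sum_comm]
        refine Finset.sum_congr rfl fun e _ => ?_
        rw [Finset.sum_comm]
        refine Finset.sum_congr rfl fun P hP => ?_
        rw [Finset.sum_comm]
        refine Finset.sum_congr rfl fun j _ => ?_
        rw [← Finset.mul_sum, sum_kloostermanWeight_pow_dvd ψ a (mem_irredPolys.1 hP).1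
          (mem_irredPolys.1 hP).2.1]
    _ = ∑ e ∈ Finset.Icc 1 n, ∑ j ∈ Finset.Icc 1 n, ∑ k ∈ Finset.Icc 1 n,
        if e * j = k then (∑ P ∈ irredPolys F e, (e : ℂ) * kloostermanWeight ψ a P ^ j)
          * ∑ h ∈ monicPolys F (n - k), kloostermanWeight ψ a h else 0 := by
        refine Finset.sum_congr rfl fun e he => ?_
        rw [Finset.sum_comm]
        refine Finset.sum_congr rfl fun j hj => ?_
        rw [Finset.sum_ite_eq]
        have : e * j ∈ Finset.Icc 1 n ↔ e * j ≤ n := by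
          rw [Finset.mem_Icc] at *
          exact ⟨fun h => h.2, fun h => ⟨Nat.mul_pos he.1 hj.1, h⟩⟩
        simp only [this]
        split_ifs
        · rw [Finset.sum_mul]
          exact Finset.sum_congr rfl fun P _ => by ring
        · simp
    _ = _ := by
        simp only [Finset.sum_mul, ite_mul, zero_mul]
        rw [Finset.sum_congr rfl fun e _ => Finset.sum_comm, Finset.sum_comm]

/-! ### Kloosterman sums over extension fields -/

open IntermediateField in
theorem adjoin_simple_inv (F : Type*) {L : Type*} [Field F] [Field L] [Algebra F L] (x : L) :
    F⟮x⁻¹⟯ = F⟮x⟯ := by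
  apply le_antisymm <;> rw [adjoin_simple_le_iff]
  · exact inv_mem (mem_adjoin_simple_self F x)
  · simpa using inv_mem (mem_adjoin_simple_self F x⁻¹)

open Polynomial IntermediateField in
theorem minpoly_inv {F L : Type*} [Field F] [Field L] [Algebra F L] {x : L} (hx : IsIntegral F x)
    (hx0 : x ≠ 0) :
    minpoly F x⁻¹ = C ((minpoly F x).coeff 0)⁻¹ * (minpoly F x).reverse := by
  have hc : (minpoly F x).coeff 0 ≠ 0 := minpoly.coeff_zero_ne_zero hx hx0
  have hadj : F⟮x⁻¹⟯ = F⟮x⟯ := adjoin_simple_inv F x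
  have hxi : IsIntegral F x⁻¹ := hx.inv
  have htd : (minpoly F x).natTrailingDegree = 0 :=
    natTrailingDegree_eq_zero.2 (Or.inr hc)
  have hdeg : (C ((minpoly F x).coeff 0)⁻¹ * (minpoly F x).reverse).natDegree
      = (minpoly F x).natDegree := by
    rw [natDegree_C_mul (inv_ne_zero hc), reverse_natDegree, htd, Nat.sub_zero]
  have hmonic : (C ((minpoly F x).coeff 0)⁻¹ * (minpoly F x).reverse).Monic := by
    rw [Monic, leadingCoeff_mul, leadingCoeff_C, reverse_leadingCoeff, trailingCoeff, htd,
      inv_mul_cancel₀ hc]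
  refine (eq_of_monic_of_dvd_of_natDegree_le (minpoly.monic hxi) hmonic
    (minpoly.dvd _ _ ?_) ?_).symm
  · let := invertibleOfNonzero hx0
    have h := (eval₂_reverse_eq_zero_iff (algebraMap F L) x (minpoly F x)).2 (minpoly.aeval F x)
    rw [invOf_eq_inv] at h
    rw [map_mul, aeval_def x⁻¹ (minpoly F x).reverse, h, mul_zero]
  · rw [hdeg, ← adjoin.finrank hx, ← adjoin.finrank hxi, hadj]

open Polynomial IntermediateField in
theorem trace_inv_eq_finrank_mul {F L : Type*} [Field F] [Field L] [Algebra F L]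
    [FiniteDimensional F L] {x : L} (hx0 : x ≠ 0) :
    Algebra.trace F L x⁻¹ = Module.finrank F⟮x⟯ L *
      -((minpoly F x).coeff 1 / (minpoly F x).coeff 0) := by
  have hx : IsIntegral F x := .of_finite F x
  have hadj : F⟮x⁻¹⟯ = F⟮x⟯ := adjoin_simple_inv F x
  have hc : (minpoly F x).coeff 0 ≠ 0 := minpoly.coeff_zero_ne_zero hx hx0
  have hnext : (minpoly F x).reverse.nextCoeff = (minpoly F x).coeff 1 := by
    rw [← coeff_one_reverse, reverse, reverse_natDegree,
      natTrailingDegree_eq_zero.2 (Or.inr hc), Nat.sub_zero, reverse, reflect_reflect]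
  rw [trace_eq_finrank_mul_minpoly_nextCoeff, hadj, minpoly_inv hx hx0, nextCoeff_C_mul, hnext]
  field_simp

open Polynomial IntermediateField in
theorem addChar_trace_eq_kloostermanWeight_pow {F L : Type*} [Field F] [Field L] [Algebra F L]
    [FiniteDimensional F L] (ψ : AddChar F ℂ) (a : F) {x : L} (hx0 : x ≠ 0) :
    ψ (Algebra.trace F L (x + algebraMap F L a * x⁻¹))
      = kloostermanWeight ψ a (minpoly F x) ^ Module.finrank F⟮x⟯ L := by
  have hc : (minpoly F x).coeff 0 ≠ 0 := minpoly.coeff_zero_ne_zero (.of_finite F x) hx0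
  rw [kloostermanWeight, if_neg hc, ← AddChar.map_nsmul_eq_pow, map_add, ← Algebra.smul_def,
    map_smul, trace_inv_eq_finrank_mul hx0, trace_eq_finrank_mul_minpoly_nextCoeff]
  congr 1
  rw [smul_eq_mul, nsmul_eq_mul]
  ring

open Polynomial in
theorem card_filter_minpoly_eq {F L : Type*} [Field F] [Fintype F] [Field L] [Fintype L]
    [Algebra F L] {P : F[X]} (hP : P.Monic) (hi : Irreducible P)
    (hdvd : P.natDegree ∣ Module.finrank F L) :
    open Classical in
    (Finset.univ.filter fun x : L => minpoly F x = P).card = P.natDegree := by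
  classical
  have h1 : P ∣ X ^ Nat.card F ^ Module.finrank F L - X :=
    hi.natDegree_dvd_iff_dvd_X_pow_card_pow_sub_X.1 hdvd
  have hcard : Nat.card F ^ Module.finrank F L = Fintype.card L := by
    rw [← Module.natCard_eq_pow_finrank, Nat.card_eq_fintype_card]
  have hsplit : (P.map (algebraMap F L)).Splits := by
    have := FiniteField.isSplittingField_sub L F
    refine Splits.of_dvd (IsSplittingField.splits L (X ^ Fintype.card L - X : F[X])) ?_ ?_
    · exact map_ne_zero (FiniteField.X_pow_card_sub_X_ne_zero _ Fintype.one_lt_card)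
    · rw [← hcard]; exact map_dvd (algebraMap F L) h1
  have hsep : P.Separable := PerfectField.separable_of_irreducible hi
  rw [← card_rootSet_eq_natDegree hsep hsplit, ← Set.toFinset_card]
  congr 1
  ext x
  rw [Finset.mem_filter, Set.mem_toFinset, mem_rootSet]
  simp only [Finset.mem_univ, true_and]
  constructor
  · rintro rfl
    exact ⟨hP.ne_zero, minpoly.aeval F x⟩
  · rintro ⟨_, h⟩
    exact (minpoly.eq_of_irreducible_of_monic hi h hP).symm

/-- The Kloosterman sum over an extension `L` of `F`, lifted through the trace, is a sum of
`kloostermanWeight` over prime powers of degree `[L : F]`. -/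
theorem kloosterman_trace_eq {F L : Type*} [Field F] [Fintype F] [Field L] [Fintype L]
    [Algebra F L] (ψ : AddChar F ℂ) (a : F) {n k : ℕ} (hk : Module.finrank F L = k) (hkn : k ≤ n) :
    kloosterman (ψ.compAddMonoidHom (Algebra.trace F L).toAddMonoidHom) (algebraMap F L a)
      = ∑ e ∈ Finset.Icc 1 n, ∑ j ∈ Finset.Icc 1 n,
          if e * j = k then ∑ P ∈ irredPolys F e, (e : ℂ) * kloostermanWeight ψ a P ^ j else 0 := by
  classical
  have hkpos : 0 < k := hk ▸ Module.finrank_pos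
  symm
  calc _ = ∑ e ∈ Finset.Icc 1 n, ∑ j ∈ Finset.Icc 1 n,
          if e * j = k then ∑ P ∈ irredPolys F e, ∑ x : L,
            (if minpoly F x = P then kloostermanWeight ψ a P ^ j else 0) else 0 := by
        refine Finset.sum_congr rfl fun e _ => Finset.sum_congr rfl fun j _ => ?_
        split_ifs with h
        · refine Finset.sum_congr rfl fun P hP => ?_
          obtain ⟨h1, h2, h3⟩ := mem_irredPolys.1 hP
          rw [← Finset.sum_filter, Finset.sum_const, card_filter_minpoly_eq h1 h3
            (by rw [h2, hk, ← h]; exact dvd_mul_right _ _), h2, nsmul_eq_mul]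
        · rfl
    _ = ∑ e ∈ Finset.Icc 1 n, ∑ j ∈ Finset.Icc 1 n, ∑ x : L,
          if e * j = k then ∑ P ∈ irredPolys F e,
            (if minpoly F x = P then kloostermanWeight ψ a P ^ j else 0) else 0 := by
        refine Finset.sum_congr rfl fun e _ => Finset.sum_congr rfl fun j _ => ?_
        split_ifs
        · exact Finset.sum_comm
        · simp
    _ = ∑ x : L, ∑ e ∈ Finset.Icc 1 n, ∑ j ∈ Finset.Icc 1 n,
          if e * j = k then (if minpoly F x ∈ irredPolys F e then
            kloostermanWeight ψ a (minpoly F x) ^ j else 0) else 0 := by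
        rw [Finset.sum_congr rfl fun e _ => Finset.sum_comm, Finset.sum_comm]
        simp only [Finset.sum_ite_eq]
    _ = _ := by
        rw [kloosterman]
        refine Finset.sum_congr rfl fun x _ => ?_
        have hint : IsIntegral F x := .of_finite F x
        have hdeg : (minpoly F x).natDegree * Module.finrank (IntermediateField.adjoin F {x}) L
            = k := by
          rw [← IntermediateField.adjoin.finrank hint, Module.finrank_mul_finrank, hk]
        have hpos := minpoly.natDegree_pos hint
        set d := (minpoly F x).natDegree with hd
        set r := Module.finrank (IntermediateField.adjoin F {x}) L with hr
        have hrpos : 0 < r := Nat.pos_of_ne_zero fun h => by rw [h] at hdeg; omega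
        have hdk : d ≤ k := by rw [← hdeg]; exact Nat.le_mul_of_pos_right _ hrpos
        have hrk : r ≤ k := by rw [← hdeg]; exact Nat.le_mul_of_pos_left _ hpos
        rw [Finset.sum_eq_single d, Finset.sum_eq_single r]
        · rw [if_pos hdeg, if_pos (mem_irredPolys.2
            ⟨minpoly.monic hint, rfl, minpoly.irreducible hint⟩)]
          split_ifs with h0
          · subst h0
            rw [kloostermanWeight, if_pos (by rw [minpoly.zero]; simp), zero_pow hrpos.ne']
          · exact (addChar_trace_eq_kloostermanWeight_pow ψ a h0).symm
        · intro j _ hj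
          refine if_neg fun h => hj ?_
          exact Nat.eq_of_mul_eq_mul_left hpos (h.trans hdeg.symm)
        · intro h; exact absurd (Finset.mem_Icc.2 ⟨hrpos, hrk.trans hkn⟩) h
        · intro e _ he
          refine Finset.sum_eq_zero fun j _ => ?_
          rw [if_neg (fun h => he (mem_irredPolys.1 h).2.1.symm), ite_self]
        · intro h; exact absurd (Finset.mem_Icc.2 ⟨hpos, hdk.trans hkn⟩) h

/-! ### Power sums of the reciprocal roots -/

/-- Newton's identities for two variables: if `n a_n = ∑ S_k a_{n-k}`, and the series of the
`a_n` is the polynomial `1 - (α + β) T + α β T²`, then the `-S_n` are the power sums of `α`, `β`. -/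
theorem eq_neg_pow_add_pow_of_recurrence {α β : ℂ} {a S : ℕ → ℂ} (h0 : a 0 = 1)
    (h1 : a 1 = -(α + β)) (h2 : a 2 = α * β) (h3 : ∀ n, a (n + 3) = 0)
    (hrec : ∀ n : ℕ, n * a n = ∑ k ∈ Finset.Icc 1 n, S k * a (n - k)) (n : ℕ) :
    S (n + 1) = -(α ^ (n + 1) + β ^ (n + 1)) := by
  have e1 : S 1 = -(α + β) := by
    have := hrec 1
    simp [h0, h1] at this
    rw [← this]; ring
  have e2 : S 2 = -(α ^ 2 + β ^ 2) := by
    have := hrec 2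
    rw [Finset.sum_Icc_succ_top (by norm_num)] at this
    simp [h0, h1, h2, e1] at this
    linear_combination -this
  have e3 : ∀ n, S (n + 3) = (α + β) * S (n + 2) - α * β * S (n + 1) := by
    intro n
    have := hrec (n + 3)
    rw [h3, mul_zero, Finset.sum_Icc_succ_top (by omega), Finset.sum_Icc_succ_top (by omega),
      Finset.sum_Icc_succ_top (by omega), Finset.sum_eq_zero] at this
    · rw [show n + 3 - (n + 1) = 2 by omega, show n + 3 - (n + 1 + 1) = 1 by omega,
        show n + 3 - (n + 2 + 1) = 0 by omega, h0, h1, h2] at this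
      linear_combination -this
    · intro k hk
      rw [Finset.mem_Icc] at hk
      obtain ⟨c, hc⟩ := Nat.exists_eq_add_of_le hk.2
      rw [show n + 3 - k = c + 3 by omega, h3, mul_zero]
  induction n using Nat.strong_induction_on with
  | _ n ih =>
    match n with
    | 0 => simpa using e1
    | 1 => exact e2
    | m + 2 =>
      rw [e3, ih (m + 1) (by omega), ih m (by omega)]
      ring

/-- The Hasse–Davenport relation for Kloosterman sums: over the extension of degree `n` the sum
is `-(αⁿ + βⁿ)`, with `α`, `β` the reciprocal roots of the `L`-function `1 + K T + q T²`. -/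
theorem kloosterman_trace_eq_neg_pow_add_pow {F : Type*} [Field F] [Fintype F] {ψ : AddChar F ℂ}
    (hψ : ψ.IsPrimitive) {a : F} (ha : a ≠ 0) {α β : ℂ} (hsum : α + β = -kloosterman ψ a)
    (hprod : α * β = Fintype.card F) {L : Type*} [Field L] [Fintype L] [Algebra F L] :
    kloosterman (ψ.compAddMonoidHom (Algebra.trace F L).toAddMonoidHom) (algebraMap F L a)
      = -(α ^ Module.finrank F L + β ^ Module.finrank F L) := by
  classical
  obtain ⟨p, hp⟩ := CharP.exists F
  have : Fact p.Prime := ⟨CharP.char_is_prime F p⟩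
  let S : ℕ → ℂ := fun k => ∑ e ∈ Finset.Icc 1 k, ∑ j ∈ Finset.Icc 1 k,
    if e * j = k then ∑ P ∈ irredPolys F e, (e : ℂ) * kloostermanWeight ψ a P ^ j else 0
  have hS : ∀ n k : ℕ, 1 ≤ k → k ≤ n → (∑ e ∈ Finset.Icc 1 n, ∑ j ∈ Finset.Icc 1 n,
      if e * j = k then ∑ P ∈ irredPolys F e, (e : ℂ) * kloostermanWeight ψ a P ^ j else 0)
        = S k := by
    intro n k hk hkn
    have : NeZero k := ⟨by omega⟩
    have := Fintype.ofFinite (FiniteField.Extension F p k)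
    rw [← kloosterman_trace_eq (L := FiniteField.Extension F p k) ψ a
      (FiniteField.finrank_extension F p k) hkn,
      kloosterman_trace_eq (L := FiniteField.Extension F p k) ψ a
      (FiniteField.finrank_extension F p k) le_rfl]
  have hψ1 : ψ ≠ 1 := by
    have := hψ one_ne_zero
    rwa [AddChar.mulShift_one] at this
  obtain ⟨n, hn⟩ := Nat.exists_eq_succ_of_ne_zero (Module.finrank_pos (R := F) (M := L)).ne'
  rw [kloosterman_trace_eq ψ a hn le_rfl, hn]
  refine eq_neg_pow_add_pow_of_recurrence (S := S)
    (a := fun n => ∑ h ∈ monicPolys F n, kloostermanWeight ψ a h)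
    (sum_kloostermanWeight_zero ψ a) ?_ ?_ (sum_kloostermanWeight_add_three hψ1 a) ?_ n
  · rw [sum_kloostermanWeight_one, hsum, neg_neg]
  · rw [sum_kloostermanWeight_two hψ ha, hprod]
  · intro n
    rw [mul_sum_kloostermanWeight]
    refine Finset.sum_congr rfl fun k hk => ?_
    rw [Finset.mem_Icc] at hk
    rw [hS n k hk.1 hk.2]

open Filter Topology in
/-- If the power sums `∑ zᵢ ^ r` have real part `O(ρ ^ r)`, then all `zᵢ` lie in the disc of radius
`ρ`: for infinitely many `r` all `zᵢ ^ r` are close to the positive axis, so there is no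
cancellation. -/
theorem norm_le_of_re_sum_pow_le {ι : Type*} [Fintype ι] {z : ι → ℂ} {C ρ : ℝ} (hρ : 0 < ρ)
    {r₀ : ℕ} (h : ∀ r ≥ r₀, (∑ i, z i ^ r).re ≤ C * ρ ^ r) (i : ι) : ‖z i‖ ≤ ρ := by
  by_contra! hi
  have hu : ∀ i, ∃ u : Circle, z i = ‖z i‖ * (u : ℂ) := by
    intro i
    refine ⟨Circle.exp (z i).arg, ?_⟩
    rw [Circle.coe_exp, Complex.norm_mul_exp_arg_mul_I]
  choose u hu using hu
  have hfreq : ∃ᶠ r : ℕ in atTop, ∀ i, (1 / 2 : ℝ) < ((u i : ℂ) ^ r).re := by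
    have h1 := mapClusterPt_one_atTop_pow u
    have hopen : IsOpen {v : ι → Circle | ∀ i, (1 / 2 : ℝ) < (v i : ℂ).re} := by
      simp only [Set.ofPred_forall]
      refine isOpen_iInter_of_finite fun i => isOpen_lt continuous_const ?_
      fun_prop
    have h2 := h1.frequently (hopen.mem_nhds (by intro i; norm_num))
    refine h2.mono fun r hr i => ?_
    simpa using hr i
  have hev : ∀ᶠ r : ℕ in atTop, C < (‖z i‖ / ρ) ^ r * (1 / 2) :=
    ((tendsto_pow_atTop_atTop_of_one_lt ((one_lt_div hρ).2 hi)).atTop_mul_const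
      (by norm_num : (0 : ℝ) < 1 / 2)).eventually_gt_atTop C
  obtain ⟨r, hr, hC, hr0⟩ := (hfreq.and_eventually (hev.and (eventually_ge_atTop r₀))).exists
  have h3 := h r hr0
  have h4 : ∀ j, ‖z j‖ ^ r * (1 / 2) ≤ (z j ^ r).re := by
    intro j
    rw [hu j, mul_pow, ← Complex.ofReal_pow, Complex.re_ofReal_mul, norm_mul, Complex.norm_real,
      norm_norm, Circle.norm_coe, mul_one]
    exact mul_le_mul_of_nonneg_left (hr j).le (by positivity)
  have h5 : ‖z i‖ ^ r * (1 / 2) ≤ C * ρ ^ r := by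
    refine le_trans ?_ h3
    rw [Complex.re_sum]
    refine (h4 i).trans (Finset.single_le_sum (f := fun j => (z j ^ r).re) (fun j _ => ?_)
      (Finset.mem_univ i))
    exact le_trans (by positivity) (h4 j)
  rw [div_pow, div_mul_eq_mul_div, lt_div_iff₀ (pow_pos hρ r)] at hC
  linarith

/-! ### A lower bound for the number of points of trace zero -/

open Polynomial in
theorem squarefree_X_pow_card_sub_X_sq_sub_C {F L : Type*} [Field F] [Fintype F] [Field L]
    [Algebra F L] (h2 : (2 : L) ≠ 0) {c : L} (hc : c ≠ 0) :
    Squarefree (((X : L[X]) ^ Fintype.card F - X) ^ 2 - C c) := by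
  apply Separable.squarefree
  have hq : (Fintype.card F : L) = 0 := by
    rw [← map_natCast (algebraMap F L), FiniteField.cast_card_eq_zero, map_zero]
  have hder : derivative (((X : L[X]) ^ Fintype.card F - X) ^ 2 - C c)
      = -(C 2 * (X ^ Fintype.card F - X)) := by
    rw [derivative_sub, derivative_C, derivative_pow, derivative_sub, derivative_X_pow, hq]
    simp
  have h3 : (C c⁻¹ : L[X]) * C c = 1 := by rw [← C_mul, inv_mul_cancel₀ hc, C_1]
  have h4 : (C 2⁻¹ : L[X]) * C 2 = 1 := by rw [← C_mul, inv_mul_cancel₀ h2, C_1]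
  refine ⟨-C c⁻¹, -(C c⁻¹ * C 2⁻¹ * (X ^ Fintype.card F - X)), ?_⟩
  rw [hder]
  linear_combination h3 + C c⁻¹ * (X ^ Fintype.card F - X) ^ 2 * h4

open Polynomial in
theorem natDegree_X_pow_sub_X_sq_sub_C {L : Type*} [Field L] {q : ℕ} (hq : 1 < q) (c : L) :
    (((X : L[X]) ^ q - X) ^ 2 - C c).natDegree = 2 * q := by
  rw [natDegree_sub_C, natDegree_pow, FiniteField.X_pow_card_sub_X_natDegree_eq L hq]

/-- If the discriminant of `X² - u X + a` is a nonzero square, then `x + a / x = u` has two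
solutions. -/
theorem two_le_card_filter_add_inv_eq {L : Type*} [Field L] [Fintype L] [DecidableEq L]
    (h2 : (2 : L) ≠ 0) {a u : L} (ha : a ≠ 0) (hne : u ^ 2 - 4 * a ≠ 0)
    (hsq : IsSquare (u ^ 2 - 4 * a)) :
    2 ≤ (Finset.univ.filter fun x : L => x ≠ 0 ∧ x + a * x⁻¹ = u).card := by
  obtain ⟨s, hs⟩ := hsq
  have hs0 : s ≠ 0 := by rintro rfl; exact hne (by rw [hs, mul_zero])
  have key : ∀ v : L, v ^ 2 = u ^ 2 - 4 * a → (u + v) / 2 ≠ 0 ∧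
      (u + v) / 2 + a * ((u + v) / 2)⁻¹ = u := by
    intro v hv
    have h0 : (u + v) ≠ 0 := by
      intro h
      have : v = -u := by linear_combination h
      rw [this] at hv
      have h4 : (2 : L) * 2 * a = 0 := by linear_combination hv
      exact mul_ne_zero (mul_ne_zero h2 h2) ha h4
    refine ⟨div_ne_zero h0 h2, ?_⟩
    field_simp
    linear_combination hv
  have hsub : ({(u + s) / 2, (u + -s) / 2} : Finset L) ⊆
      Finset.univ.filter fun x : L => x ≠ 0 ∧ x + a * x⁻¹ = u := by
    intro x hx
    rw [Finset.mem_insert, Finset.mem_singleton] at hx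
    rw [Finset.mem_filter]
    rcases hx with rfl | rfl
    · exact ⟨Finset.mem_univ _, key s (by rw [hs, sq])⟩
    · exact ⟨Finset.mem_univ _, key (-s) (by rw [hs]; ring)⟩
  refine le_trans (le_of_eq ?_) (Finset.card_le_card hsub)
  rw [Finset.card_pair]
  intro h
  field_simp at h
  have : (2 : L) * s = 0 := by linear_combination h
  exact mul_ne_zero h2 hs0 this

open Polynomial in
/-- Lower bound for the number of `x` with `Tr (x + a / x) = 0` over the extension of degree `2r`
of a field with `q` elements. The equation `z ^ q - z = x + a / x` is solvable in `x` when
the discriminant `(z ^ q - z)² - 4a` is a square, which by Stepanov's bound is the case for about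
half of all `z`. -/
theorem le_card_mul_card_trace_eq_zero {F L : Type*} [Field F] [Fintype F] [Field L]
    [Fintype L] [Algebra F L] [DecidableEq L] [DecidableEq F] (hodd : Odd (Fintype.card F)) {r : ℕ}
    (hr : 2 ≤ r) (hrank : Module.finrank F L = 2 * r) {a : L} (ha : a ≠ 0) :
    Fintype.card L ≤ Fintype.card F * (Finset.univ.filter fun x : L =>
        x ≠ 0 ∧ Algebra.trace F L (x + a * x⁻¹) = 0).card
      + 8 * Fintype.card F * Fintype.card F ^ r := by
  set q := Fintype.card F with hq
  have hq3 : 3 ≤ q := by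
    have := Fintype.one_lt_card (α := F)
    obtain ⟨k, hk⟩ := hodd
    omega
  have hcardL : Fintype.card L = (q ^ r) ^ 2 := by
    rw [Module.card_eq_pow_finrank (K := F), hrank, ← hq, ← pow_mul, mul_comm]
  obtain ⟨p, hpF, s, hp, hps⟩ := FiniteField.card' F
  have := Fact.mk hp
  have hpL : CharP L p := charP_of_injective_algebraMap (algebraMap F L).injective p
  have : ExpChar L p := ExpChar.prime hp
  have hPodd : Odd (q ^ r) := hodd.pow
  have hchar : ringChar L ≠ 2 := by
    intro h
    have := FiniteField.even_card_iff_char_two.1 h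
    rw [hcardL] at this
    exact Nat.not_even_iff_odd.2 hPodd.pow (Nat.even_iff.2 this)
  have h2 : (2 : L) ≠ 0 := Ring.two_ne_zero hchar
  obtain ⟨h, hh⟩ := hPodd
  have hhalf : Fintype.card L / 2 = 2 * h ^ 2 + 2 * h := by
    rw [hcardL, hh]
    have : (2 * h + 1) ^ 2 = 2 * (2 * h ^ 2 + 2 * h) + 1 := by ring
    omega
  have h4a : 4 * a ≠ 0 := by
    have : (4 : L) = 2 * 2 := by norm_num
    rw [this]; exact mul_ne_zero (mul_ne_zero h2 h2) ha
  set f : L[X] := (X ^ q - X) ^ 2 - C (4 * a) with hf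
  have hfeval : ∀ z, f.eval z = (z ^ q - z) ^ 2 - 4 * a := by intro z; simp [hf]
  have hfdeg : f.natDegree = 2 * q := natDegree_X_pow_sub_X_sq_sub_C (by omega) _
  have hqh : q ≤ h := by
    have h1 : q ^ 2 ≤ q ^ r := Nat.pow_le_pow_right (by omega) hr
    have : 2 * q + 1 ≤ q ^ 2 := by nlinarith
    omega
  have hst := two_mul_card_filter_pow_eq_le (K := L) (p := p) (e := s * r) (h := h)
    (by rw [pow_mul, ← hps, hh]) (by rw [hcardL, hh])
    (f := f) (squarefree_X_pow_card_sub_X_sq_sub_C h2 h4a) (m := q) (by omega) hqh hfdeg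
    (by rw [hfeval]; simpa [show q ≠ 0 by omega] using h4a) (-1)
  have hzeros : (Finset.univ.filter fun z : L => f.eval z = 0).card ≤ 2 * q := by
    have hf0 : f ≠ 0 := by intro h; rw [h, natDegree_zero] at hfdeg; omega
    refine le_trans (Finset.card_le_card (t := f.roots.toFinset) fun z hz => ?_)
      ((Multiset.toFinset_card_le _).trans (hfdeg ▸ card_roots' f))
    rw [Multiset.mem_toFinset, mem_roots hf0]
    exact (Finset.mem_filter.1 hz).2
  set good := Finset.univ.filter fun z : L => f.eval z ≠ 0 ∧ IsSquare (f.eval z) with hgood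
  -- `z` is good unless the discriminant is zero or has quadratic character `-1`
  have hcover : Fintype.card L ≤ good.card
      + (Finset.univ.filter fun x : L => f.eval x ^ (2 * h ^ 2 + 2 * h) = -1).card
      + (Finset.univ.filter fun z : L => f.eval z = 0).card := by
    rw [← Finset.card_univ]
    refine le_trans (Finset.card_le_card (fun z _ => ?_))
      ((Finset.card_union_le _ _).trans (Nat.add_le_add_right (Finset.card_union_le _ _) _))
    by_cases hz : f.eval z = 0
    · exact Finset.mem_union_right _ (Finset.mem_filter.2 ⟨Finset.mem_univ _, hz⟩)
    refine Finset.mem_union_left _ ?_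
    rcases FiniteField.pow_dichotomy hchar hz with h1 | h1
    · exact Finset.mem_union_left _ (Finset.mem_filter.2
        ⟨Finset.mem_univ _, hz, (FiniteField.isSquare_iff hchar hz).2 h1⟩)
    · rw [hhalf] at h1
      exact Finset.mem_union_right _ (Finset.mem_filter.2 ⟨Finset.mem_univ _, h1⟩)
  have hdouble := Finset.sum_card_bipartiteAbove_eq_sum_card_bipartiteBelow
    (s := (Finset.univ : Finset L)) (t := (Finset.univ : Finset L))
    (fun z x => x ≠ 0 ∧ x + a * x⁻¹ = z ^ q - z)
  have hlower : 2 * good.card ≤ ∑ z : L, (Finset.bipartiteAbove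
      (fun z x => x ≠ 0 ∧ x + a * x⁻¹ = z ^ q - z) (Finset.univ : Finset L) z).card := by
    rw [mul_comm, ← smul_eq_mul, ← Finset.sum_const]
    refine (Finset.sum_le_sum fun z hz => ?_).trans
      (Finset.sum_le_sum_of_subset (Finset.subset_univ good))
    obtain ⟨_, h1, h3⟩ := Finset.mem_filter.1 hz
    rw [hfeval] at h1 h3
    exact two_le_card_filter_add_inv_eq h2 ha h1 h3
  have hupper : ∑ x : L, (Finset.bipartiteBelow
      (fun z x => x ≠ 0 ∧ x + a * x⁻¹ = z ^ q - z) (Finset.univ : Finset L) x).card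
      ≤ q * (Finset.univ.filter fun x : L =>
        x ≠ 0 ∧ Algebra.trace F L (x + a * x⁻¹) = 0).card := by
    rw [mul_comm, ← smul_eq_mul, ← Finset.sum_const, Finset.sum_filter]
    refine Finset.sum_le_sum fun x _ => ?_
    split_ifs with hx
    · -- `z ^ q - z = u` has at most `q` solutions
      have hd : (X ^ q - X - C (x + a * x⁻¹) : L[X]).natDegree = q := by
        rw [natDegree_sub_C, FiniteField.X_pow_card_sub_X_natDegree_eq L (by omega)]
      have h0 : (X ^ q - X - C (x + a * x⁻¹) : L[X]) ≠ 0 := by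
        intro h; rw [h, natDegree_zero] at hd; omega
      refine le_trans (Finset.card_le_card (t := (X ^ q - X - C (x + a * x⁻¹)).roots.toFinset)
        fun z hz => ?_) ((Multiset.toFinset_card_le _).trans (hd ▸ card_roots' _))
      rw [Multiset.mem_toFinset, mem_roots h0]
      have := (Finset.mem_bipartiteBelow _).1 hz
      simp [this.2.2]
    · rw [Nat.le_zero, Finset.card_eq_zero, Finset.eq_empty_iff_forall_notMem]
      intro z hz
      have := ((Finset.mem_bipartiteBelow _).1 hz).2
      refine hx ⟨this.1, ?_⟩
      have htr := Algebra.trace_eq_of_algEquiv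
        (FiniteField.frobeniusAlgEquivOfAlgebraic F L) z
      rw [FiniteField.coe_frobeniusAlgEquivOfAlgebraic] at htr
      rw [this.2, map_sub, sub_eq_zero]
      exact htr
  have hpow : 2 * q ≤ 2 * q * (2 * h + 1) := Nat.le_mul_of_pos_right _ (by omega)
  rw [hh]
  rw [hcardL, hh] at hcover ⊢
  nlinarith

/-! ### Weil's bound for Kloosterman sums -/

theorem isPrimitive_mulShift {F : Type*} [Field F] {ψ : AddChar F ℂ} (hψ : ψ.IsPrimitive) {b : F}
    (hb : b ≠ 0) : (ψ.mulShift b).IsPrimitive := by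
  intro c hc
  rw [AddChar.mulShift_mulShift]
  exact hψ (mul_ne_zero hb hc)

/-- Orthogonality, summing Kloosterman sums over all characters of the base field. -/
theorem sum_kloosterman_trace_mulShift {F L : Type*} [Field F] [Fintype F] [Field L] [Fintype L]
    [Algebra F L] [DecidableEq L] [DecidableEq F] {ψ : AddChar F ℂ} (hψ : ψ.IsPrimitive) (a : L) :
    ∑ b : F, kloosterman
        ((ψ.mulShift b).compAddMonoidHom (Algebra.trace F L).toAddMonoidHom) a
      = Fintype.card F * (Finset.univ.filter fun x : L =>
        x ≠ 0 ∧ Algebra.trace F L (x + a * x⁻¹) = 0).card := by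
  unfold kloosterman
  rw [Finset.sum_comm, mul_comm, ← nsmul_eq_mul, ← Finset.sum_const, Finset.sum_filter]
  refine Finset.sum_congr rfl fun x _ => ?_
  by_cases hx : x = 0
  · simp [hx]
  · simp only [hx, if_false, ne_eq, not_false_eq_true, true_and]
    have := AddChar.sum_mulShift (Algebra.trace F L (x + a * x⁻¹)) hψ
    rw [Nat.cast_ite, Nat.cast_zero] at this
    rw [← this]
    rfl

theorem kloosterman_mulShift_zero {L F : Type*} [Field L] [Fintype L] [Field F] [Algebra F L]
    (ψ : AddChar F ℂ) (a : L) :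
    kloosterman ((ψ.mulShift 0).compAddMonoidHom (Algebra.trace F L).toAddMonoidHom) a
      = Fintype.card L - 1 := by
  classical
  have h : ∀ x : L, ((ψ.mulShift 0).compAddMonoidHom (Algebra.trace F L).toAddMonoidHom) x = 1 := by
    intro x; simp
  unfold kloosterman
  simp only [h]
  rw [← Finset.sum_erase_add _ _ (Finset.mem_univ (0 : L)), if_pos rfl, add_zero,
    Finset.sum_congr rfl fun x hx => if_neg (Finset.ne_of_mem_erase hx), Finset.sum_const,
    Finset.card_erase_of_mem (Finset.mem_univ _), Finset.card_univ, nsmul_eq_mul, mul_one,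
    Nat.cast_pred Fintype.card_pos]

theorem exists_add_eq_mul_eq (s t : ℂ) : ∃ α β : ℂ, α + β = s ∧ α * β = t := by
  obtain ⟨w, hw⟩ := IsAlgClosed.exists_pow_nat_eq (s ^ 2 - 4 * t) (n := 2) (by norm_num)
  exact ⟨(s + w) / 2, (s - w) / 2, by ring, by linear_combination -hw / 4⟩

/-- **Weil's bound** for Kloosterman sums over finite fields of odd order. -/
theorem norm_kloosterman_le {F : Type*} [Field F] [Fintype F] (hodd : Odd (Fintype.card F))
    {ψ : AddChar F ℂ} (hψ : ψ.IsPrimitive) {a : F} (ha : a ≠ 0) :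
    ‖kloosterman ψ a‖ ≤ 2 * √(Fintype.card F) := by
  classical
  set q := Fintype.card F with hq
  have hqpos : 0 < q := Fintype.card_pos
  choose α β hsum hprod using fun b : F =>
    exists_add_eq_mul_eq (-kloosterman (ψ.mulShift b) a) (q : ℂ)
  let z : F × Bool → ℂ := fun i =>
    if i.1 = 0 then 0 else if i.2 then α i.1 ^ 2 else β i.1 ^ 2
  obtain ⟨p, hp⟩ := CharP.exists F
  have : Fact p.Prime := ⟨CharP.char_is_prime F p⟩
  -- only extensions of even degree `2r` are used, so that their order is a square
  have hz : ∀ r ≥ 2, (∑ i, z i ^ r).re ≤ (8 * q : ℝ) * (q : ℝ) ^ r := by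
    intro r hr
    have : NeZero (2 * r) := ⟨by omega⟩
    let L := FiniteField.Extension F p (2 * r)
    have := Fintype.ofFinite L
    have hrank : Module.finrank F L = 2 * r := FiniteField.finrank_extension F p (2 * r)
    have ha' : algebraMap F L a ≠ 0 := by simpa using ha
    have h1 := le_card_mul_card_trace_eq_zero (L := L) hodd hr hrank ha'
    have h2 := sum_kloosterman_trace_mulShift (L := L) hψ (algebraMap F L a)
    rw [← Finset.add_sum_erase _ _ (Finset.mem_univ (0 : F)), kloosterman_mulShift_zero] at h2
    have h3 : ∑ b ∈ Finset.univ.erase (0 : F), kloosterman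
        ((ψ.mulShift b).compAddMonoidHom (Algebra.trace F L).toAddMonoidHom) (algebraMap F L a)
        = -∑ i, z i ^ r := by
      rw [Fintype.sum_prod_type, ← Finset.add_sum_erase Finset.univ _ (Finset.mem_univ (0 : F))]
      have h0 : ∑ y, z (0, y) ^ r = 0 :=
        Finset.sum_eq_zero fun y _ => by simp [z, show r ≠ 0 by omega]
      rw [h0, zero_add, ← Finset.sum_neg_distrib]
      refine Finset.sum_congr rfl fun b hb => ?_
      have hb0 := Finset.ne_of_mem_erase hb
      rw [kloosterman_trace_eq_neg_pow_add_pow (isPrimitive_mulShift hψ hb0) ha (hsum b) (hprod b),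
        hrank, Fintype.sum_bool]
      simp [z, hb0, pow_mul]
    rw [h3] at h2
    have h4 := congrArg Complex.re h2
    simp only [Complex.add_re, Complex.sub_re, Complex.natCast_re, Complex.one_re,
      Complex.neg_re] at h4
    rw [← Nat.cast_mul, Complex.natCast_re] at h4
    have h5 : (Fintype.card L : ℝ) ≤ ((q * _ + 8 * q * q ^ r : ℕ) : ℝ) := Nat.cast_le.2 h1
    rw [Nat.cast_add] at h5
    push_cast at h5 h4 ⊢
    linarith
  have hle := norm_le_of_re_sum_pow_le (by positivity) hz
  have hsqrt : ∀ w : ℂ, ‖w ^ 2‖ ≤ q → ‖w‖ ≤ √q := fun w hw =>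
    Real.le_sqrt_of_sq_le (by rwa [← norm_pow])
  have hα := hsqrt (α 1) (by simpa [z] using hle (1, true))
  have hβ := hsqrt (β 1) (by simpa [z] using hle (1, false))
  have h1 := hsum 1
  rw [AddChar.mulShift_one] at h1
  rw [← norm_neg, ← h1]
  linarith [norm_add_le (α 1) (β 1)]

/-! ### Gauss, Kloosterman and Salié sums -/

/-- The quadratic character of a finite field, with complex values. -/
noncomputable def quadChar (F : Type*) [Field F] [Fintype F] [DecidableEq F] : MulChar F ℂ :=
  (quadraticChar F).ringHomComp (Int.castRingHom ℂ)

theorem quadChar_isQuadratic (F : Type*) [Field F] [Fintype F] [DecidableEq F] :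
    (quadChar F).IsQuadratic :=
  (quadraticChar_isQuadratic F).comp _

theorem quadChar_ne_one {F : Type*} [Field F] [Fintype F] [DecidableEq F] (hF : ringChar F ≠ 2) :
    quadChar F ≠ 1 :=
  (MulChar.ringHomComp_ne_one_iff (Int.cast_injective)).2 (quadraticChar_ne_one hF)

theorem quadChar_sq {F : Type*} [Field F] [Fintype F] [DecidableEq F] {s : F} (hs : s ≠ 0) :
    quadChar F s ^ 2 = 1 := by
  simp only [quadChar, MulChar.ringHomComp_apply, eq_intCast]
  exact_mod_cast quadraticChar_sq_one hs

theorem norm_quadChar {F : Type*} [Field F] [Fintype F] [DecidableEq F] {s : F} (hs : s ≠ 0) :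
    ‖quadChar F s‖ = 1 := by
  have h := congrArg norm (quadChar_sq hs)
  rw [norm_pow, norm_one] at h
  exact (pow_eq_one_iff_of_nonneg (norm_nonneg _) two_ne_zero).1 h

theorem sum_addChar_mul_sq {F : Type*} [Field F] [Fintype F] [DecidableEq F]
    (hF : ringChar F ≠ 2) {ψ : AddChar F ℂ} (hψ : ψ.IsPrimitive) {s : F} (hs : s ≠ 0) :
    ∑ x, ψ (s * x ^ 2) = quadChar F s * gaussSum (quadChar F) ψ := by
  have h1 : ∑ x, ψ (s * x ^ 2) = ∑ u, (quadChar F u + 1) * ψ (s * u) := by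
    rw [← Finset.sum_fiberwise (Finset.univ : Finset F) (fun x => x ^ 2)]
    refine Finset.sum_congr rfl fun u _ => ?_
    rw [Finset.sum_congr rfl fun x hx => by rw [(Finset.mem_filter.1 hx).2], Finset.sum_const,
      nsmul_eq_mul]
    have h := quadraticChar_card_sqrts hF u
    have h2 : (Finset.univ.filter fun x : F => x ^ 2 = u) = {x | x ^ 2 = u}.toFinset := by
      ext; simp
    rw [h2]
    have h3 := congrArg (Int.cast : ℤ → ℂ) h
    push_cast at h3
    rw [h3]
    rfl
  have h2 := AddChar.sum_mulShift s hψ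
  rw [if_neg hs] at h2
  have h3 := gaussSum_mulShift (quadChar F) ψ (Units.mk0 s hs)
  rw [Units.val_mk0] at h3
  rw [h1, ← h3, ← mul_assoc, ← sq, quadChar_sq hs, one_mul, gaussSum]
  simp only [add_mul, Finset.sum_add_distrib, one_mul, AddChar.mulShift_apply]
  simp only [mul_comm _ s] at h2
  rw [h2]; simp

theorem norm_gaussSum_quadChar {F : Type*} [Field F] [Fintype F] [DecidableEq F]
    (hF : ringChar F ≠ 2) {ψ : AddChar F ℂ} (hψ : ψ.IsPrimitive) :
    ‖gaussSum (quadChar F) ψ‖ = √(Fintype.card F) := by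
  have h := congrArg norm (gaussSum_sq (quadChar_ne_one hF) (quadChar_isQuadratic F) hψ)
  rw [norm_pow, norm_mul, norm_quadChar (neg_ne_zero.2 one_ne_zero), one_mul,
    Complex.norm_natCast] at h
  rw [← h, Real.sqrt_sq (norm_nonneg _)]

/-- Completing the square. -/
theorem sum_addChar_quadratic {F : Type*} [Field F] [Fintype F] [DecidableEq F]
    (hF : ringChar F ≠ 2) {ψ : AddChar F ℂ} (hψ : ψ.IsPrimitive) {s : F} (hs : s ≠ 0) (m : F) :
    ∑ x, ψ (s * x ^ 2 + m * x)
      = quadChar F s * gaussSum (quadChar F) ψ * ψ (-(m ^ 2 / 4) * s⁻¹) := by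
  have h2 : (2 : F) ≠ 0 := Ring.two_ne_zero hF
  have h4 : (4 : F) ≠ 0 := by
    have : (4 : F) = 2 * 2 := by norm_num
    rw [this]; exact mul_ne_zero h2 h2
  rw [← sum_addChar_mul_sq hF hψ hs, Finset.sum_mul,
    ← Equiv.sum_comp (Equiv.addRight (m / (2 * s))) fun x => ψ (s * x ^ 2) * _]
  refine Finset.sum_congr rfl fun x _ => ?_
  rw [← AddChar.map_add_eq_mul, Equiv.coe_addRight]
  congr 1
  field_simp
  ring

/-- The Kloosterman and Salié sums `∑_{s ≠ 0} χ(s)^d ψ(u s + v / s)`, `χ` the quadratic character,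
according to the parity of `d`. -/
noncomputable def twistedKloosterman {F : Type*} [Field F] [Fintype F] [DecidableEq F]
    (ψ : AddChar F ℂ) (d : ℕ) (u v : F) : ℂ :=
  ∑ s ∈ Finset.univ.erase (0 : F), quadChar F s ^ d * ψ (u * s + v * s⁻¹)

theorem twistedKloosterman_rescale {F : Type*} [Field F] [Fintype F] [DecidableEq F]
    (ψ : AddChar F ℂ) (d : ℕ) (u v : F) {c : F} (hc : c ≠ 0) :
    twistedKloosterman ψ d u v
      = quadChar F c ^ d * twistedKloosterman ψ d (u * c) (v * c⁻¹) := by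
  unfold twistedKloosterman
  rw [Finset.mul_sum]
  symm
  refine Finset.sum_equiv (Equiv.mulLeft₀ c hc) (fun s => by simp [hc]) fun s _ => ?_
  have hcs : Equiv.mulLeft₀ c hc s = c * s := rfl
  rw [hcs, ← mul_assoc, ← mul_pow, ← map_mul]
  congr 2
  rw [mul_inv]; ring

theorem norm_twistedKloosterman_le_of_even {F : Type*} [Field F] [Fintype F] [DecidableEq F]
    (hodd : Odd (Fintype.card F)) {ψ : AddChar F ℂ} (hψ : ψ.IsPrimitive) {d : ℕ} (hd : Even d)
    {u : F} (hu : u ≠ 0) (v : F) :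
    ‖twistedKloosterman ψ d u v‖ ≤ 2 * √(Fintype.card F) := by
  have hone : ∀ s : F, s ≠ 0 → quadChar F s ^ d = 1 := by
    obtain ⟨e, rfl⟩ := hd
    intro s hs
    rw [← two_mul, pow_mul, quadChar_sq hs, one_pow]
  rw [twistedKloosterman_rescale ψ d u v (inv_ne_zero hu), hone _ (inv_ne_zero hu), one_mul,
    mul_inv_cancel₀ hu, inv_inv]
  have h : twistedKloosterman ψ d 1 (v * u) = kloosterman ψ (v * u) := by
    classical
    rw [twistedKloosterman, kloosterman, ← Finset.sum_erase_add _ _ (Finset.mem_univ (0 : F)),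
      if_pos rfl, add_zero]
    refine Finset.sum_congr rfl fun s hs => ?_
    have hs0 := Finset.ne_of_mem_erase hs
    rw [hone s hs0, one_mul, one_mul, if_neg hs0]
  by_cases hv : v = 0
  · -- the sum of a nontrivial character over the nonzero elements is `-1`
    have hsum := AddChar.sum_mulShift (1 : F) hψ
    rw [if_neg one_ne_zero] at hsum
    have h1 : twistedKloosterman ψ d 1 (v * u) = -1 := by
      rw [twistedKloosterman, Finset.sum_congr rfl fun s hs => by
        rw [hone s (Finset.ne_of_mem_erase hs), hv, zero_mul, zero_mul, add_zero, one_mul,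
          mul_comm (1 : F) s]]
      rw [← Finset.add_sum_erase _ _ (Finset.mem_univ (0 : F))] at hsum
      simp only [zero_mul, AddChar.map_zero_eq_one, Nat.cast_zero] at hsum
      linear_combination hsum
    rw [h1, norm_neg, norm_one]
    have : (1 : ℝ) ≤ √(Fintype.card F) := Real.one_le_sqrt.2 (by exact_mod_cast Fintype.card_pos)
    linarith
  · rw [h]
    exact norm_kloosterman_le hodd hψ (mul_ne_zero hv hu)

/-- The Salié sums are evaluated by completing the square: up to a Gauss sum, they are
sums of `ψ (m x)` over the at most two solutions of `x² = -u`. -/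
theorem norm_twistedKloosterman_neg_sq_le {F : Type*} [Field F] [Fintype F] [DecidableEq F]
    (hF : ringChar F ≠ 2) {ψ : AddChar F ℂ} (hψ : ψ.IsPrimitive) (u m : F) :
    ‖twistedKloosterman ψ 1 u (-(m ^ 2 / 4))‖ ≤ 2 * √(Fintype.card F) := by
  set q := Fintype.card F with hq
  set G := gaussSum (quadChar F) ψ with hG
  have hGnorm : ‖G‖ = √q := norm_gaussSum_quadChar hF hψ
  have hqpos : 0 < √(q : ℝ) := Real.sqrt_pos.2 (by exact_mod_cast Fintype.card_pos)
  have h1 : G * twistedKloosterman ψ 1 u (-(m ^ 2 / 4))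
      = ∑ x, ψ (m * x) * (if x ^ 2 = -u then (q : ℂ) else 0) - ∑ x, ψ (m * x) := by
    have h2 : G * twistedKloosterman ψ 1 u (-(m ^ 2 / 4))
        = ∑ s ∈ Finset.univ.erase (0 : F), ∑ x, ψ (m * x) * ψ (s * (x ^ 2 + u)) := by
      rw [twistedKloosterman, Finset.mul_sum]
      refine Finset.sum_congr rfl fun s hs => ?_
      have := sum_addChar_quadratic hF hψ (Finset.ne_of_mem_erase hs) m
      rw [AddChar.map_add_eq_mul, pow_one]
      calc _ = ψ (u * s) * (quadChar F s * G * ψ (-(m ^ 2 / 4) * s⁻¹)) := by ring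
        _ = _ := by
          rw [← this, Finset.mul_sum]
          refine Finset.sum_congr rfl fun x _ => ?_
          rw [← AddChar.map_add_eq_mul, ← AddChar.map_add_eq_mul]
          congr 1; ring
    rw [h2, Finset.sum_comm, ← Finset.sum_sub_distrib]
    refine Finset.sum_congr rfl fun x _ => ?_
    have h3 := AddChar.sum_mulShift (x ^ 2 + u) hψ
    rw [← Finset.add_sum_erase _ _ (Finset.mem_univ (0 : F)), zero_mul,
      AddChar.map_zero_eq_one] at h3
    simp only [add_eq_zero_iff_eq_neg] at h3
    rw [← Finset.mul_sum, eq_sub_of_add_eq' h3]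
    push_cast
    ring
  have h2 : ‖G * twistedKloosterman ψ 1 u (-(m ^ 2 / 4))‖ ≤ 2 * q := by
    rw [h1]
    have hcard : (Finset.univ.filter fun x : F => x ^ 2 = -u).card ≤ 2 := by
      have h := quadraticChar_card_sqrts hF (-u)
      have h2 : (Finset.univ.filter fun x : F => x ^ 2 = -u) = {x | x ^ 2 = -u}.toFinset := by
        ext; simp
      have h3 : quadraticChar F (-u) ≤ 1 := by
        rcases quadraticChar_isQuadratic F (-u) with h | h | h <;> rw [h] <;> norm_num
      rw [h2]; omega
    by_cases hm : m = 0
    · subst hm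
      simp only [zero_mul, AddChar.map_zero_eq_one, one_mul, Finset.sum_const, Finset.card_univ,
        nsmul_eq_mul, mul_one]
      rw [← Finset.sum_filter, Finset.sum_const, nsmul_eq_mul]
      generalize (Finset.univ.filter fun x : F => x ^ 2 = -u).card = N at hcard
      have : (N : ℂ) * q - q = ((N - 1 : ℝ) * q : ℝ) := by push_cast; ring
      rw [← hq, this, Complex.norm_real, Real.norm_eq_abs, abs_mul, Nat.abs_cast]
      refine mul_le_mul_of_nonneg_right ?_ (Nat.cast_nonneg _)
      have : (N : ℝ) ≤ 2 := by exact_mod_cast hcard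
      rw [abs_le]; constructor <;> linarith [(Nat.cast_nonneg N : (0 : ℝ) ≤ N)]
    · have h0 := AddChar.sum_mulShift m hψ
      rw [if_neg hm] at h0
      simp only [mul_comm _ m] at h0
      rw [h0, Nat.cast_zero, sub_zero]
      simp only [mul_ite, mul_zero]
      rw [← Finset.sum_filter]
      refine (norm_sum_le_of_le _ (f := fun x => ψ (m * x) * q) (n := fun _ => (q : ℝ))
        fun x _ => ?_).trans ?_
      · rw [norm_mul, AddChar.norm_apply, one_mul, Complex.norm_natCast]
      · rw [Finset.sum_const, nsmul_eq_mul]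
        exact mul_le_mul_of_nonneg_right (by exact_mod_cast hcard) (Nat.cast_nonneg _)
  rw [norm_mul, hGnorm] at h2
  refine le_of_mul_le_mul_left (h2.trans (le_of_eq ?_)) hqpos
  have := Real.mul_self_sqrt (Nat.cast_nonneg (α := ℝ) q)
  linear_combination -2 * this

theorem norm_twistedKloosterman_le {F : Type*} [Field F] [Fintype F] [DecidableEq F]
    (hodd : Odd (Fintype.card F)) {ψ : AddChar F ℂ} (hψ : ψ.IsPrimitive) (d : ℕ)
    {u : F} (hu : u ≠ 0) (v : F) :
    ‖twistedKloosterman ψ d u v‖ ≤ 2 * √(Fintype.card F) := by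
  have hF : ringChar F ≠ 2 := fun h => by
    have := FiniteField.even_card_iff_char_two.1 h
    exact Nat.not_even_iff_odd.2 hodd (Nat.even_iff.2 this)
  rcases Nat.even_or_odd d with hd | hd
  · exact norm_twistedKloosterman_le_of_even hodd hψ hd hu v
  have h1 : ∀ u v : F, twistedKloosterman ψ d u v = twistedKloosterman ψ 1 u v := by
    intro u v
    refine Finset.sum_congr rfl fun s hs => ?_
    obtain ⟨e, rfl⟩ := hd
    rw [pow_add, pow_mul, quadChar_sq (Finset.ne_of_mem_erase hs), one_pow, one_mul]
  have h4 : (4 : F) ≠ 0 := by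
    have h2 : (2 : F) ≠ 0 := Ring.two_ne_zero hF
    have : (4 : F) = 2 * 2 := by norm_num
    rw [this]; exact mul_ne_zero h2 h2
  rw [h1]
  by_cases hv : v = 0
  · have := norm_twistedKloosterman_neg_sq_le hF hψ u 0
    simpa [hv] using this
  · -- rescaling by `c = -4v` makes the second parameter `-1 / 4`
    have hc : -4 * v ≠ 0 := mul_ne_zero (neg_ne_zero.2 h4) hv
    have h5 : v * (-4 * v)⁻¹ = -((1 : F) ^ 2 / 4) := by field_simp
    rw [twistedKloosterman_rescale ψ 1 u v hc, norm_mul, norm_pow, norm_quadChar hc, one_pow,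
      one_mul, h5]
    exact norm_twistedKloosterman_neg_sq_le hF hψ _ 1

/-! ### Fourier analysis of spheres -/

theorem addChar_sum_eq_prod {F : Type*} [Field F] (ψ : AddChar F ℂ) {d : ℕ} (f : Fin d → F) :
    ψ (∑ i, f i) = ∏ i, ψ (f i) :=
  map_prod ψ.toMonoidHom (fun i => Multiplicative.ofAdd (f i)) Finset.univ

theorem sum_addChar_dotProduct {F : Type*} [Field F] [Fintype F] [DecidableEq F]
    {ψ : AddChar F ℂ} (hψ : ψ.IsPrimitive) {d : ℕ} (z : Fin d → F) :
    ∑ m : Fin d → F, ψ (m ⬝ᵥ z) = if z = 0 then (Fintype.card F : ℂ) ^ d else 0 := by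
  have h1 : ∑ m : Fin d → F, ψ (m ⬝ᵥ z) = ∏ i, ∑ x, ψ (x * z i) := by
    rw [Finset.prod_univ_sum, Fintype.piFinset_univ]
    exact Finset.sum_congr rfl fun m _ => addChar_sum_eq_prod ψ _
  rw [h1]
  split_ifs with h
  · subst h
    simp
  · obtain ⟨i, hi⟩ := Function.ne_iff.1 h
    refine Finset.prod_eq_zero (Finset.mem_univ i) ?_
    have := AddChar.sum_mulShift (z i) hψ
    rwa [if_neg (show z i ≠ 0 from hi), Nat.cast_zero] at this

/-- Fourier expansion of `z ↦ ψ (s ‖z‖)` in the additive characters of `F^d`. -/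
theorem card_pow_mul_addChar_distForm {F : Type*} [Field F] [Fintype F] [DecidableEq F]
    (hF : ringChar F ≠ 2) {ψ : AddChar F ℂ} (hψ : ψ.IsPrimitive) {s : F} (hs : s ≠ 0) {d : ℕ}
    (z : Fin d → F) :
    (Fintype.card F : ℂ) ^ d * ψ (s * distForm z)
      = ∑ m : Fin d → F, (quadChar F s * gaussSum (quadChar F) ψ) ^ d *
          ψ (-(distForm m / 4) * s⁻¹) * ψ (m ⬝ᵥ z) := by
  have h1 : ∀ w : F, (Fintype.card F : ℂ) * ψ (s * w ^ 2)
      = ∑ m, quadChar F s * gaussSum (quadChar F) ψ * ψ (-(m ^ 2 / 4) * s⁻¹) * ψ (m * w) := by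
    intro w
    simp only [← sum_addChar_quadratic hF hψ hs, Finset.sum_mul]
    rw [Finset.sum_comm]
    have h2 : ∀ x : F, ∑ m, ψ (s * x ^ 2 + m * x) * ψ (m * w)
        = if x = -w then (Fintype.card F : ℂ) * ψ (s * w ^ 2) else 0 := by
      intro x
      have h3 := AddChar.sum_mulShift (x + w) hψ
      simp only [add_eq_zero_iff_eq_neg, Nat.cast_ite, Nat.cast_zero] at h3
      calc _ = ψ (s * x ^ 2) * ∑ m, ψ (m * (x + w)) := by
            rw [Finset.mul_sum]
            refine Finset.sum_congr rfl fun m _ => ?_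
            rw [← AddChar.map_add_eq_mul, ← AddChar.map_add_eq_mul]
            congr 1; ring
        _ = _ := by
            rw [h3]
            split_ifs with h
            · rw [h, neg_sq, mul_comm]
            · rw [mul_zero]
    rw [Finset.sum_congr rfl fun x _ => h2 x, Finset.sum_ite_eq' _ _ _, if_pos (Finset.mem_univ _)]
  calc _ = ∏ i, ((Fintype.card F : ℂ) * ψ (s * z i ^ 2)) := by
        rw [Finset.prod_mul_distrib, Finset.prod_const, Finset.card_univ, Fintype.card_fin,
          distForm, Finset.mul_sum, addChar_sum_eq_prod]
    _ = _ := by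
        simp only [h1]
        rw [Finset.prod_univ_sum, Fintype.piFinset_univ]
        refine Finset.sum_congr rfl fun m _ => ?_
        rw [Finset.prod_mul_distrib, Finset.prod_mul_distrib, Finset.prod_const, Finset.card_univ,
          Fintype.card_fin, ← addChar_sum_eq_prod, ← addChar_sum_eq_prod, distForm,
          Finset.sum_div, ← Finset.sum_neg_distrib, Finset.sum_mul]
        rfl

/-- Fourier expansion of the indicator function of a sphere; the coefficients are (twisted)
Kloosterman sums. -/
theorem card_pow_mul_sphere_indicator {F : Type*} [Field F] [Fintype F] [DecidableEq F]
    (hF : ringChar F ≠ 2) {ψ : AddChar F ℂ} (hψ : ψ.IsPrimitive) {d : ℕ} (t : F)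
    (z : Fin d → F) :
    (Fintype.card F : ℂ) ^ d * ((Fintype.card F : ℂ) * (if distForm z = t then 1 else 0) - 1)
      = ∑ m : Fin d → F, gaussSum (quadChar F) ψ ^ d *
          twistedKloosterman ψ d (-t) (-(distForm m / 4)) * ψ (m ⬝ᵥ z) := by
  have h1 := AddChar.sum_mulShift (distForm z - t) hψ
  rw [← Finset.add_sum_erase _ _ (Finset.mem_univ (0 : F)), zero_mul,
    AddChar.map_zero_eq_one] at h1
  simp only [sub_eq_zero, Nat.cast_ite, Nat.cast_zero] at h1
  rw [mul_ite, mul_one, mul_zero, ← h1, add_sub_cancel_left, Finset.mul_sum]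
  simp only [twistedKloosterman, Finset.mul_sum, Finset.sum_mul]
  rw [Finset.sum_comm]
  refine Finset.sum_congr rfl fun s hs => ?_
  have h2 := card_pow_mul_addChar_distForm hF hψ (Finset.ne_of_mem_erase hs) z
  rw [mul_sub, sub_eq_add_neg, AddChar.map_add_eq_mul, ← mul_assoc, h2, Finset.sum_mul]
  refine Finset.sum_congr rfl fun m _ => ?_
  rw [AddChar.map_add_eq_mul, mul_pow, ← mul_neg, mul_comm s (-t)]
  ring

/-- Plancherel's identity on `F^d`. -/
theorem sum_norm_sq_fourier {F : Type*} [Field F] [Fintype F] [DecidableEq F]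
    {ψ : AddChar F ℂ} (hψ : ψ.IsPrimitive) {d : ℕ} (f : (Fin d → F) → ℝ) :
    ∑ m : Fin d → F, ‖∑ x, (f x : ℂ) * ψ (m ⬝ᵥ x)‖ ^ 2
      = (Fintype.card F : ℝ) ^ d * ∑ x, f x ^ 2 := by
  have h : ∀ m : Fin d → F, ((‖∑ x, (f x : ℂ) * ψ (m ⬝ᵥ x)‖ ^ 2 : ℝ) : ℂ)
      = ∑ x, ∑ y, (f x : ℂ) * f y * ψ (m ⬝ᵥ (x - y)) := by
    intro m
    rw [Complex.ofReal_pow, ← Complex.mul_conj', map_sum, Finset.sum_mul_sum]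
    refine Finset.sum_congr rfl fun x _ => Finset.sum_congr rfl fun y _ => ?_
    rw [map_mul, Complex.conj_ofReal, ← AddChar.map_neg_eq_conj, dotProduct_sub, sub_eq_add_neg,
      AddChar.map_add_eq_mul]
    ring
  apply Complex.ofReal_injective
  rw [Complex.ofReal_sum, Finset.sum_congr rfl fun m _ => h m, Finset.sum_comm]
  push_cast
  rw [Finset.mul_sum]
  refine Finset.sum_congr rfl fun x _ => ?_
  rw [Finset.sum_comm, Finset.sum_eq_single x]
  · rw [← Finset.mul_sum, sum_addChar_dotProduct hψ, if_pos (sub_self x)]; ring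
  · intro y _ hy
    rw [← Finset.mul_sum, sum_addChar_dotProduct hψ, if_neg (sub_ne_zero.2 hy.symm), mul_zero]
  · intro h; exact absurd (Finset.mem_univ x) h

/-- The distance graph of `F^d` is pseudorandom: the bilinear form of its adjacency matrix, minus
the density `1 / q`, is bounded by the size of the Fourier coefficients of the sphere. -/
theorem abs_sum_distForm_le {F : Type*} [Field F] [Fintype F] [DecidableEq F]
    (hodd : Odd (Fintype.card F)) {d : ℕ} {t : F} (ht : t ≠ 0) (f g : (Fin d → F) → ℝ) :
    |∑ x, ∑ y, f x * g y *
        ((Fintype.card F : ℝ) * (if distForm (x - y) = t then 1 else 0) - 1)|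
      ≤ 2 * √(Fintype.card F) ^ (d + 1) * (√(∑ x, f x ^ 2) * √(∑ x, g x ^ 2)) := by
  obtain ⟨ψ, hψ⟩ : ∃ ψ : AddChar F ℂ, ψ.IsPrimitive := by
    obtain ⟨ψ, hψ⟩ := AddChar.exists_apply_ne_zero.2 (one_ne_zero (α := F))
    exact ⟨ψ, AddChar.IsPrimitive.of_ne_one fun h => hψ (by rw [h, AddChar.one_apply])⟩
  have hF : ringChar F ≠ 2 := fun h => by
    have := FiniteField.even_card_iff_char_two.1 h
    exact Nat.not_even_iff_odd.2 hodd (Nat.even_iff.2 this)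
  set q := Fintype.card F with hq
  have hqpos : (0 : ℝ) < q := by exact_mod_cast Fintype.card_pos
  set B := ∑ x, ∑ y, f x * g y * ((q : ℝ) * (if distForm (x - y) = t then 1 else 0) - 1) with hB
  have h1 : (q : ℂ) ^ d * (B : ℂ) = ∑ m : Fin d → F, gaussSum (quadChar F) ψ ^ d *
      twistedKloosterman ψ d (-t) (-(distForm m / 4)) *
      ((∑ x, (f x : ℂ) * ψ (m ⬝ᵥ x)) * (starRingEnd ℂ) (∑ y, (g y : ℂ) * ψ (m ⬝ᵥ y))) := by
    have h2 : ∀ x y : Fin d → F, (q : ℂ) ^ d * ((f x : ℂ) * g y *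
        ((q : ℂ) * (if distForm (x - y) = t then 1 else 0) - 1))
        = ∑ m : Fin d → F, gaussSum (quadChar F) ψ ^ d *
          twistedKloosterman ψ d (-t) (-(distForm m / 4)) *
          ((f x : ℂ) * ψ (m ⬝ᵥ x) * (starRingEnd ℂ) ((g y : ℂ) * ψ (m ⬝ᵥ y))) := by
      intro x y
      rw [mul_left_comm, card_pow_mul_sphere_indicator hF hψ, Finset.mul_sum]
      refine Finset.sum_congr rfl fun m _ => ?_
      rw [map_mul, Complex.conj_ofReal, ← AddChar.map_neg_eq_conj, dotProduct_sub, sub_eq_add_neg,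
        AddChar.map_add_eq_mul]
      ring
    have h3 : (B : ℂ) = ∑ x, ∑ y, (f x : ℂ) * g y *
        ((q : ℂ) * (if distForm (x - y) = t then 1 else 0) - 1) := by
      rw [hB]; push_cast; simp only [apply_ite (Complex.ofReal), Complex.ofReal_one,
        Complex.ofReal_zero]
    rw [h3]
    simp only [map_sum, Finset.sum_mul_sum]
    simp only [Finset.mul_sum, h2]
    rw [Finset.sum_congr rfl fun x _ => Finset.sum_comm, Finset.sum_comm]
  have h4 : (q : ℝ) ^ d * |B| ≤ √q ^ d * (2 * √q) *
      ∑ m : Fin d → F, ‖∑ x, (f x : ℂ) * ψ (m ⬝ᵥ x)‖ * ‖∑ y, (g y : ℂ) * ψ (m ⬝ᵥ y)‖ := by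
    have h5 := congrArg norm h1
    rw [norm_mul, norm_pow, Complex.norm_natCast, Complex.norm_real, Real.norm_eq_abs] at h5
    rw [h5, Finset.mul_sum]
    refine norm_sum_le_of_le _ fun m _ => ?_
    rw [norm_mul, norm_mul, norm_mul, norm_pow, norm_gaussSum_quadChar hF hψ, RCLike.norm_conj]
    gcongr
    exact norm_twistedKloosterman_le hodd hψ d (neg_ne_zero.2 ht) _
  have h5 := Real.sum_mul_le_sqrt_mul_sqrt Finset.univ
    (fun m : Fin d → F => ‖∑ x, (f x : ℂ) * ψ (m ⬝ᵥ x)‖)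
    (fun m : Fin d → F => ‖∑ y, (g y : ℂ) * ψ (m ⬝ᵥ y)‖)
  rw [sum_norm_sq_fourier hψ, sum_norm_sq_fourier hψ, Real.sqrt_mul (by positivity),
    Real.sqrt_mul (by positivity), ← hq] at h5
  have h6 : √((q : ℝ) ^ d) * √((q : ℝ) ^ d) = (q : ℝ) ^ d := Real.mul_self_sqrt (by positivity)
  refine le_of_mul_le_mul_left (h4.trans ((mul_le_mul_of_nonneg_left h5 (by positivity)).trans
    (le_of_eq ?_))) (pow_pos hqpos d)
  linear_combination 2 * √q ^ (d + 1) * (√(∑ x, f x ^ 2) * √(∑ x, g x ^ 2)) * h6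

/-! ### Counting paths -/

open Classical in
/-- The number of paths in `E` with the prescribed distances that start at `x`. -/
noncomputable def pathsFrom {F : Type*} [Field F] [Fintype F] {d k : ℕ}
    (E : Finset (Fin d → F)) (t : Fin k → F) (x : Fin d → F) : ℝ :=
  ∑ p : Fin k → Fin d → F, if (Fin.cons x p : Fin (k + 1) → Fin d → F) ∈ pathSet E t then 1 else 0

theorem pathCount_eq_sum_pathsFrom {F : Type*} [Field F] [Fintype F] {d k : ℕ}
    (E : Finset (Fin d → F)) (t : Fin k → F) :
    (pathCount E t : ℝ) = ∑ x, pathsFrom E t x := by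
  classical
  unfold pathsFrom
  have h := Fintype.sum_equiv (Fin.consEquiv fun _ : Fin (k + 1) => Fin d → F)
    (fun p => if (Fin.cons p.1 p.2 : Fin (k + 1) → Fin d → F) ∈ pathSet E t then (1 : ℝ) else 0)
    (fun p => if p ∈ pathSet E t then 1 else 0) fun _ => rfl
  rw [pathCount, Set.ncard_eq_toFinset_card', ← Fintype.sum_prod_type', h, Finset.sum_boole]
  congr 2
  ext; simp

theorem pathsFrom_zero {F : Type*} [Field F] [Fintype F] [DecidableEq F] {d : ℕ}
    (E : Finset (Fin d → F)) (t : Fin 0 → F) (x : Fin d → F) :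
    pathsFrom E t x = if x ∈ E then 1 else 0 := by
  classical
  simp [pathsFrom, pathSet]

theorem cons_mem_pathSet {F : Type*} [Field F] {d k : ℕ} (E : Finset (Fin d → F))
    (t : Fin (k + 1) → F) (x y : Fin d → F) (p : Fin k → Fin d → F) :
    (Fin.cons x (Fin.cons y p : Fin (k + 1) → Fin d → F) : Fin (k + 2) → Fin d → F) ∈ pathSet E t
      ↔ x ∈ E ∧ distForm (x - y) = t 0 ∧
        (Fin.cons y p : Fin (k + 1) → Fin d → F) ∈ pathSet E (Fin.tail t) := by
  simp only [pathSet, Set.mem_ofPred_eq]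
  rw [Fin.forall_fin_succ (n := k + 1)]
  rw [Fin.forall_fin_succ (P := fun i : Fin (k + 1) => _ = t i)]
  simp only [Fin.cons_zero, Fin.cons_succ, Fin.castSucc_zero, ← Fin.succ_castSucc, Fin.tail]
  tauto

theorem pathsFrom_succ {F : Type*} [Field F] [Fintype F] [DecidableEq F] {d k : ℕ}
    (E : Finset (Fin d → F)) (t : Fin (k + 1) → F) (x : Fin d → F) :
    pathsFrom E t x = (if x ∈ E then 1 else 0) *
      ∑ y, (if distForm (x - y) = t 0 then 1 else 0) * pathsFrom E (Fin.tail t) y := by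
  classical
  unfold pathsFrom
  rw [← Fintype.sum_equiv (Fin.consEquiv fun _ : Fin (k + 1) => Fin d → F)
    (fun p => if (Fin.cons x (Fin.cons p.1 p.2 : Fin (k + 1) → Fin d → F) :
      Fin (k + 2) → Fin d → F) ∈ pathSet E t then (1 : ℝ) else 0) _ fun _ => rfl,
    Fintype.sum_prod_type, Finset.mul_sum]
  refine Finset.sum_congr rfl fun y _ => ?_
  rw [Finset.mul_sum, Finset.mul_sum]
  refine Finset.sum_congr rfl fun p _ => ?_
  simp only [cons_mem_pathSet]
  split_ifs <;> simp_all

/-- The function counting paths in `E` by their starting point is close to the constant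
`(|E| / q)^k` on `E`, in the `ℓ²` sense (stated by duality). Each step replaces the adjacency
operator by its main term `|E| / q`, with an error of operator norm at most
`lam = 2 q^{(d+1)/2} / q`. -/
theorem abs_sum_mul_pathsFrom_sub_le {F : Type*} [Field F] [Fintype F] [DecidableEq F]
    (hodd : Odd (Fintype.card F)) {d : ℕ} (E : Finset (Fin d → F)) {A lam : ℝ}
    (hA : A = E.card / Fintype.card F)
    (hlam : lam = 2 * √(Fintype.card F) ^ (d + 1) / Fintype.card F) (k : ℕ) :
    ∀ (t : Fin k → F), (∀ i, t i ≠ 0) → ∀ g : (Fin d → F) → ℝ,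
      |∑ x, g x * pathsFrom E t x - A ^ k * ∑ x ∈ E, g x|
        ≤ √(∑ x, g x ^ 2) * √E.card * ((A + lam) ^ k - A ^ k) := by
  have hqpos : (0 : ℝ) < Fintype.card F := by exact_mod_cast Fintype.card_pos
  have hA0 : 0 ≤ A := by rw [hA]; positivity
  have hlam0 : 0 ≤ lam := by rw [hlam]; positivity
  have hsqrtE : √(E.card : ℝ) * √E.card = E.card := Real.mul_self_sqrt (Nat.cast_nonneg _)
  have hCS : ∀ g : (Fin d → F) → ℝ, |∑ x ∈ E, g x| ≤ √(∑ x, g x ^ 2) * √E.card := by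
    intro g
    have h1 : (∑ x ∈ E, g x) ^ 2 ≤ (∑ x, g x ^ 2) * E.card := by
      have := sq_sum_le_card_mul_sum_sq (s := E) (f := g)
      refine this.trans ?_
      rw [mul_comm]
      exact mul_le_mul_of_nonneg_right (Finset.sum_le_sum_of_subset_of_nonneg
        (Finset.subset_univ _) fun _ _ _ => sq_nonneg _) (Nat.cast_nonneg _)
    rw [← Real.sqrt_mul (Finset.sum_nonneg fun _ _ => sq_nonneg _)]
    exact Real.abs_le_sqrt h1
  induction k with
  | zero =>
    intro t _ g
    simp [pathsFrom_zero]
  | succ k ih =>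
    intro t ht g
    have ih' := ih (Fin.tail t) fun i => ht _
    set N := pathsFrom E (Fin.tail t) with hN
    set D := (A + lam) ^ k - A ^ k with hD
    have hD0 : 0 ≤ D := sub_nonneg.2 (pow_le_pow_left₀ hA0 (by linarith) k)
    -- testing the induction hypothesis against `N` itself bounds the `ℓ²` norm of `N`
    have hNnorm : √(∑ x, N x ^ 2) ≤ √E.card * (A + lam) ^ k := by
      have h1 := ih' N
      have h2 := hCS N
      have h3 : ∑ x, N x * N x = √(∑ x, N x ^ 2) * √(∑ x, N x ^ 2) := by
        rw [Real.mul_self_sqrt (Finset.sum_nonneg fun _ _ => sq_nonneg _)]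
        exact Finset.sum_congr rfl fun x _ => (sq _).symm
      rcases (Real.sqrt_nonneg (∑ x, N x ^ 2)).eq_or_lt with h0 | h0
      · rw [← h0]; positivity
      refine le_of_mul_le_mul_left ?_ h0
      rw [← h3]
      have h4 := (abs_le.1 h1).2
      have h5 := mul_le_mul_of_nonneg_left (abs_le.1 h2).2 (pow_nonneg hA0 k)
      rw [hD] at h4
      linarith
    have hNsum : |∑ x, (if x ∈ E then N x else 0) - A ^ k * E.card| ≤ E.card * D := by
      have := ih' fun x => if x ∈ E then 1 else 0
      simp only [ite_mul, one_mul, zero_mul, ite_pow, one_pow, ne_eq, OfNat.ofNat_ne_zero,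
        not_false_eq_true, zero_pow, Finset.sum_ite_mem, Finset.univ_inter, Finset.sum_const,
        nsmul_eq_mul, mul_one, Finset.inter_self, hsqrtE] at this
      simpa only [Finset.sum_ite_mem, Finset.univ_inter] using this
    have hNE : ∀ x, (if x ∈ E then N x else 0) = N x := by
      intro x
      split_ifs with h
      · rfl
      · symm
        refine Finset.sum_eq_zero fun p _ => if_neg fun hp => h ?_
        simpa using hp.1 0
    simp only [hNE] at hNsum
    set gE : (Fin d → F) → ℝ := fun x => if x ∈ E then g x else 0 with hgE
    have hgEsum : ∑ x, gE x = ∑ x ∈ E, g x := by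
      simp [hgE]
    have hgEnorm : √(∑ x, gE x ^ 2) ≤ √(∑ x, g x ^ 2) := by
      refine Real.sqrt_le_sqrt (Finset.sum_le_sum fun x _ => ?_)
      simp only [hgE]
      split_ifs
      · rfl
      · rw [zero_pow two_ne_zero]; exact sq_nonneg _
    have hB := abs_sum_distForm_le hodd (ht 0) gE N
    have hsplit : ∑ x, ∑ y, gE x * N y *
        ((Fintype.card F : ℝ) * (if distForm (x - y) = t 0 then 1 else 0) - 1)
        = Fintype.card F * ∑ x, g x * pathsFrom E t x - (∑ x ∈ E, g x) * ∑ y, N y := by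
      rw [← hgEsum, Finset.sum_mul_sum, Finset.mul_sum, ← Finset.sum_sub_distrib]
      refine Finset.sum_congr rfl fun x _ => ?_
      rw [pathsFrom_succ, Finset.mul_sum, Finset.mul_sum, Finset.mul_sum,
        ← Finset.sum_sub_distrib]
      refine Finset.sum_congr rfl fun y _ => ?_
      simp only [hgE]
      split_ifs <;> ring
    rw [hsplit] at hB
    set T := ∑ x, g x * pathsFrom E t x
    set q := (Fintype.card F : ℝ)
    set n := (E.card : ℝ)
    set G := √(∑ x, g x ^ 2)
    have hG0 : 0 ≤ G := Real.sqrt_nonneg _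
    have hqA : q * A = n := by rw [hA]; field_simp
    have hql : q * lam = 2 * √q ^ (d + 1) := by rw [hlam]; field_simp
    have hB' : |q * T - (∑ x ∈ E, g x) * ∑ y, N y| ≤ q * lam * (G * (√n * (A + lam) ^ k)) := by
      refine hB.trans ?_
      rw [hql]
      gcongr
    have hsum' : |(∑ x ∈ E, g x) * ∑ y, N y - (∑ x ∈ E, g x) * (A ^ k * n)|
        ≤ (G * √n) * (n * D) := by
      rw [← mul_sub, abs_mul]
      exact mul_le_mul (hCS g) hNsum (abs_nonneg _) (by positivity)
    have htotal : q * |T - A ^ (k + 1) * ∑ x ∈ E, g x|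
        ≤ q * (G * √n * ((A + lam) ^ (k + 1) - A ^ (k + 1))) := by
      rw [← abs_of_pos hqpos, ← abs_mul, abs_of_pos hqpos]
      calc _ = |(q * T - (∑ x ∈ E, g x) * ∑ y, N y)
            + ((∑ x ∈ E, g x) * ∑ y, N y - (∑ x ∈ E, g x) * (A ^ k * n))| := by
            congr 1; rw [← hqA]; ring
        _ ≤ _ := (abs_add_le _ _).trans (add_le_add hB' hsum')
        _ = _ := by rw [hD, ← hqA]; ring
    exact le_of_mul_le_mul_left htotal hqpos

/-- By convexity of `exp`, it lies below its chord on `[0, log 2]`. -/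
theorem one_add_pow_sub_one_le {u : ℝ} (hu : 0 ≤ u) {k : ℕ} (hk : k * u ≤ Real.log 2) :
    (1 + u) ^ k - 1 ≤ k * u / Real.log 2 := by
  have hlog : 0 < Real.log 2 := Real.log_pos one_lt_two
  have h1 : (1 + u) ^ k ≤ Real.exp (k * u) := by
    rw [Real.exp_nat_mul]
    exact pow_le_pow_left₀ (by linarith) (by linarith [Real.add_one_le_exp u]) k
  set θ := k * u / Real.log 2 with hθ
  have hθ1 : θ ≤ 1 := (div_le_one hlog).2 hk
  have hθ0 : 0 ≤ θ := by positivity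
  have h2 := convexOn_exp.2 (Set.mem_univ 0) (Set.mem_univ (Real.log 2))
    (sub_nonneg.2 hθ1) hθ0 (by ring)
  have h3 : θ * Real.log 2 = k * u := by rw [hθ]; field_simp
  simp only [smul_eq_mul, mul_zero, zero_add, Real.exp_zero, mul_one, h3,
    Real.exp_log two_pos] at h2
  linarith

theorem theorem1 {F : Type*} [Field F] [Fintype F] (hq : Odd (Fintype.card F))
    (d : ℕ) (hd : 2 ≤ d) (k : ℕ) (t : Fin k → F) (ht : ∀ i, t i ≠ 0)
    (E : Finset (Fin d → F))
    (hE : 2 * (k : ℝ) / Real.log 2 * (Fintype.card F : ℝ) ^ (((d : ℝ) + 1) / 2)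
      < (E.card : ℝ)) :
    |(pathCount E t : ℝ) - (E.card : ℝ) ^ (k + 1) / (Fintype.card F : ℝ) ^ k|
        ≤ 2 * (k : ℝ) / Real.log 2 * (Fintype.card F : ℝ) ^ (((d : ℝ) + 1) / 2)
          * ((E.card : ℝ) ^ k / (Fintype.card F : ℝ) ^ k)
      ∧ 0 < pathCount E t := by
  classical
  set q := (Fintype.card F : ℝ) with hqdef
  have hqpos : 0 < q := by rw [hqdef]; exact_mod_cast Fintype.card_pos
  have hlog : 0 < Real.log 2 := Real.log_pos one_lt_two
  have hpow : q ^ (((d : ℝ) + 1) / 2) = √q ^ (d + 1) := by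
    rw [Real.sqrt_eq_rpow, ← Real.rpow_natCast, ← Real.rpow_mul hqpos.le]
    congr 1; push_cast; ring
  rw [hpow] at hE ⊢
  set n := (E.card : ℝ) with hn
  set R := √q ^ (d + 1) with hR
  have hRpos : 0 < R := by positivity
  have hnpos : 0 < n := lt_of_le_of_lt (by positivity) hE
  have h1 := abs_sum_mul_pathsFrom_sub_le hq E (A := n / q) (lam := 2 * R / q) rfl rfl k t ht
    (fun x => if x ∈ E then 1 else 0)
  have hsupp : ∀ x, (if x ∈ E then (1 : ℝ) else 0) * pathsFrom E t x = pathsFrom E t x := by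
    intro x
    split_ifs with h
    · rw [one_mul]
    · rw [zero_mul]
      symm
      refine Finset.sum_eq_zero fun p _ => if_neg fun hp => h ?_
      simpa using hp.1 0
  simp only [hsupp] at h1
  rw [← pathCount_eq_sum_pathsFrom] at h1
  simp only [ite_pow, one_pow, ne_eq, OfNat.ofNat_ne_zero, not_false_eq_true, zero_pow,
    Finset.sum_ite_mem, Finset.univ_inter, Finset.inter_self, Finset.sum_const, nsmul_eq_mul,
    mul_one] at h1
  rw [← hn, Real.mul_self_sqrt hnpos.le] at h1
  have hmain : (n / q) ^ k * n = n ^ (k + 1) / q ^ k := by rw [div_pow]; ring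
  rw [hmain] at h1
  have h2 : n * ((n / q + 2 * R / q) ^ k - (n / q) ^ k)
      ≤ 2 * k / Real.log 2 * R * (n ^ k / q ^ k) := by
    have h3 := one_add_pow_sub_one_le (u := 2 * R / n) (by positivity) (k := k) (by
      rw [div_mul_eq_mul_div, div_lt_iff₀ hlog] at hE
      rw [mul_div_assoc', div_le_iff₀ hnpos]
      linarith)
    have h4 : n / q + 2 * R / q = n / q * (1 + 2 * R / n) := by field_simp
    rw [h4, mul_pow]
    calc _ = n * (n / q) ^ k * ((1 + 2 * R / n) ^ k - 1) := by ring
      _ ≤ n * (n / q) ^ k * (k * (2 * R / n) / Real.log 2) := by gcongr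
      _ = _ := by rw [div_pow]; field_simp
  have h3 := h1.trans h2
  refine ⟨h3, ?_⟩
  have h4 : 2 * k / Real.log 2 * R * (n ^ k / q ^ k) < n * (n ^ k / q ^ k) :=
    mul_lt_mul_of_pos_right hE (by positivity)
  have h5 : n * (n ^ k / q ^ k) = n ^ (k + 1) / q ^ k := by ring
  have h6 := (abs_le.1 h3).1
  have h7 : (0 : ℝ) < pathCount E t := by linarith
  exact_mod_cast h7
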